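/- **Theorem 5.5.** Let $1\le k<d$ be integers and let $f:\mathbb R^d\to\mathbb R$ be twice differentiable. Suppose that - $f$ is $L$-smooth: $\|\nabla f(x)-\nabla f(y)\|\le L\|x-y\|$ for all $x,y\in\mathbb R^d$; - $f$ is $\mu$-strongly convex with $\mu>0$: $f(ax+(1-a)y)\le af(x)+(1-a)f(y)-\frac{a(1-a)\mu}{2}\|x-y\|^2$ for all $x,y\in\mathbb R^d$, $a\in[0,1]$; - $f$ is $M$-strongly self-concordant with $M\ge 0$: $\nabla^2f(y)-\nabla^2f(x)\preceq M\|y-x\|_z\nabla^2f(w)$ for all $x,y,z,w\in\mathbb R^d$, where $\|v\|_z=(v^\top\nabla^2f(z)v)^{1/2}$. Put $\varkappa=L/\mu$ and $\lambda(x)=\sqrt{\nabla f(x)^\top(\nabla^2f(x))^{-1}\nabla f(x)}$. For $G,A\in\mathbb R^{d\times d}$ and $U\in\mathbb R^{d\times k}$ define $$\mathrm{BlockBFGS}(G,A,U)=G-GU(U^\top GU)^{-1}U^\top G+AU(U^\top AU)^{-1}U^\top A,$$ $$\mathrm{BlockDFP}(G,A,U)=AU(U^\top AU)^{-1}U^\top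 A+\bigl(I_d-AU(U^\top AU)^{-1}U^\top\bigr)G\bigl(I_d-U(U^\top AU)^{-1}U^\top A\bigr).$$ The randomized block BFGS method (respectively, the randomized block DFP method) starts from $x_0\in\mathbb R^d$, $G_0\in\mathbb R^{d\times d}$ and computes, for $t=0,1,2,\dots$, $$x_{t+1}=x_t-G_t^{-1}\nabla f(x_t),\qquad r_t=\|x_{t+1}-x_t\|_{x_t},\qquad \tilde G_t=(1+Mr_t)G_t,$$ $$G_{t+1}=\mathrm{BlockBFGS}(\tilde G_t,\nabla^2f(x_{t+1}),U_t)\quad\text{(respectively, } G_{t+1}=\mathrm{BlockDFP}(\tilde G_t,\nabla^2f(x_{t+1}),U_t)),$$ where $U_t\in\mathbb R^{d\times k}$ are random matrices all of whose entries (over all $t$) are independent standard normal variables. Suppose that, for some $\eta_0\ge 1$, $$M\lambda(x_0)\le\frac{\ln 2}{4}\cdot\frac{d\varkappa-k}{\eta_0d^2\varkappa}\qquad\text{and}\qquad\nabla^2f(x_0)\preceq G_0\preceq\eta_0\nabla^2f(x_0).$$ Then for each of the two methods and every $t\ge 0$ the random variable $\lambda(x_{t+1})/\lambda(x_t)$ (with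 the convention $0/0=0$; if $\lambda(x_t)=0$ then $x_{t+1}=x_t$ is the minimizer) is integrable and $$\mathbb E\left[\frac{\lambda(x_{t+1})}{\lambda(x_t)}\right]\le 2d\eta_0\left(1-\frac{k}{d\varkappa}\right)^t .$$ -/

import Mathlib

open MeasureTheory ProbabilityTheory
open scoped Matrix MatrixOrder

noncomputable section

namespace BlockQN

/-- The Hessian matrix of `f` at `x`: the Jacobian matrix of the gradient in the standard basis. -/
def hess {d : ℕ} (f : EuclideanSpace ℝ (Fin d) → ℝ) (x : EuclideanSpace ℝ (Fin d)) :
    Matrix (Fin d) (Fin d) ℝ :=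
  Matrix.of fun i j => (fderiv ℝ (gradient f) x (EuclideanSpace.single j 1)) i

/-- The weighted norm `(vᵀ A v)^(1/2)`. -/
def wnorm {d : ℕ} (A : Matrix (Fin d) (Fin d) ℝ) (v : EuclideanSpace ℝ (Fin d)) : ℝ :=
  Real.sqrt (v.ofLp ⬝ᵥ (A *ᵥ v.ofLp))

/-- The local gradient norm `(∇f(x)ᵀ (∇²f(x))⁻¹ ∇f(x))^(1/2)`. -/
def localGradNorm {d : ℕ} (f : EuclideanSpace ℝ (Fin d) → ℝ)
    (x : EuclideanSpace ℝ (Fin d)) : ℝ :=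
  wnorm (hess f x)⁻¹ (gradient f x)

/-- `f` is twice differentiable on the whole space. -/
def TwiceDifferentiable {d : ℕ} (f : EuclideanSpace ℝ (Fin d) → ℝ) : Prop :=
  Differentiable ℝ f ∧ Differentiable ℝ (gradient f)

/-- `f` is `L`-smooth: its gradient is `L`-Lipschitz. -/
def IsSmoothWith {d : ℕ} (L : ℝ) (f : EuclideanSpace ℝ (Fin d) → ℝ) : Prop :=
  ∀ x y, ‖gradient f x - gradient f y‖ ≤ L * ‖x - y‖

/-- `f` is `M`-strongly self-concordant (`≤` is the Loewner order on matrices). -/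
def StronglySelfConcordant {d : ℕ} (M : ℝ) (f : EuclideanSpace ℝ (Fin d) → ℝ) : Prop :=
  ∀ x y w z, hess f y - hess f x ≤ (M * wnorm (hess f z) (y - x)) • hess f w

/-- The block BFGS update of the estimator `G` towards the target `A` along `U`. -/
def blockBFGS {d k : ℕ} (G A : Matrix (Fin d) (Fin d) ℝ) (U : Matrix (Fin d) (Fin k) ℝ) :
    Matrix (Fin d) (Fin d) ℝ :=
  G - G * U * (Uᵀ * G * U)⁻¹ * Uᵀ * G + A * U * (Uᵀ * A * U)⁻¹ * Uᵀ * A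

/-- The block DFP update of the estimator `G` towards the target `A` along `U`. -/
def blockDFP {d k : ℕ} (G A : Matrix (Fin d) (Fin d) ℝ) (U : Matrix (Fin d) (Fin k) ℝ) :
    Matrix (Fin d) (Fin d) ℝ :=
  A * U * (Uᵀ * A * U)⁻¹ * Uᵀ * A
    + (1 - A * U * (Uᵀ * A * U)⁻¹ * Uᵀ) * G * (1 - U * (Uᵀ * A * U)⁻¹ * Uᵀ * A)

/-- The two variants of the method. -/
inductive Variant
  | bfgs
  | dfp

/-- The matrix update used by each variant. -/
def Variant.update (v : Variant) {d k : ℕ} (G A : Matrix (Fin d) (Fin d) ℝ)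
    (U : Matrix (Fin d) (Fin k) ℝ) : Matrix (Fin d) (Fin d) ℝ :=
  match v with
  | .bfgs => blockBFGS G A U
  | .dfp => blockDFP G A U

/-- The quasi-Newton step `x - G⁻¹ ∇f(x)`. -/
def nextPoint {d : ℕ} (f : EuclideanSpace ℝ (Fin d) → ℝ) (x : EuclideanSpace ℝ (Fin d))
    (G : Matrix (Fin d) (Fin d) ℝ) : EuclideanSpace ℝ (Fin d) :=
  x - WithLp.toLp 2 (G⁻¹ *ᵥ (gradient f x).ofLp)

/-- The new Hessian estimator: `G` is first scaled by `1 + M r`, where `r` is the length of the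
step in the local norm at `x`, and then updated along `U` towards the Hessian at the new point. -/
def nextEstimator (v : Variant) {d k : ℕ} (f : EuclideanSpace ℝ (Fin d) → ℝ) (M : ℝ)
    (x : EuclideanSpace ℝ (Fin d)) (G : Matrix (Fin d) (Fin d) ℝ)
    (U : Matrix (Fin d) (Fin k) ℝ) : Matrix (Fin d) (Fin d) ℝ :=
  v.update ((1 + M * wnorm (hess f x) (nextPoint f x G - x)) • G) (hess f (nextPoint f x G)) U

/-- The pair `(x_t, G_t)` produced by the method from `(x₀, G₀)` with the directions
`U 0, U 1, …`. -/
def iterate (v : Variant) {d k : ℕ} (f : EuclideanSpace ℝ (Fin d) → ℝ) (M : ℝ)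
    (x₀ : EuclideanSpace ℝ (Fin d)) (G₀ : Matrix (Fin d) (Fin d) ℝ)
    (U : ℕ → Matrix (Fin d) (Fin k) ℝ) :
    ℕ → EuclideanSpace ℝ (Fin d) × Matrix (Fin d) (Fin d) ℝ
  | 0 => (x₀, G₀)
  | t + 1 =>
    let s := iterate v f M x₀ G₀ U t
    (nextPoint f s.1 s.2, nextEstimator v f M s.1 s.2 (U t))

/-- All entries of all the random matrices `U 0, U 1, …` are i.i.d. standard normal variables. -/
def IsGaussianDirections {Ω : Type*} [MeasurableSpace Ω] (P : Measure Ω) {d k : ℕ}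
    (U : ℕ → Ω → Matrix (Fin d) (Fin k) ℝ) : Prop :=
  (∀ t i j, HasLaw (fun ω => U t ω i j) (gaussianReal 0 1) P) ∧
    iIndepFun (fun (p : ℕ × Fin d × Fin k) (ω : Ω) => U p.1 ω p.2.1 p.2.2) P

end BlockQN

end

/-! Write `H` for the Hessian at the current point, `u = M λ` for the scaled local gradient norm, `κ
= L / μ` and `ρ = 1 - k / (d κ)`. Suppose `H ≤ G ≤ η H`. Strong self-concordance gives `λ' ≤ λ (1 +
u/2) (1 - 1/η + u/2)` for the next point (`IsRegular.localGradNorm_nextPoint_le`), so the ratio `λ'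
/ λ` is small once `G` is close to `H` and `u` is small. The closeness is measured by `σ = tr (H⁻¹
(G - H))`; since `G ≤ (1 + σ) H`, the bound also holds with `1 + σ` in place of `η`.

Averaging over `U` contracts `σ`. For `A ≤ G` both updates lie above `A` and below the DFP update,
whose trace error is explicit (`trace_blockDFP`): it drops by `tr (U (Uᵀ A U)⁻¹ Uᵀ (G - A))`. Since
`A ≤ L I`, this drop is at least `L⁻¹` times the trace against the orthogonal projection onto the
range of `U`. That projection has mean `(k/d) I` by the symmetries of the Gaussian law, and `A ≥ μ
I` then gives the factor `ρ`. Moving to the new point costs a factor `(1 + u)²` and an additive term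
of order `d u` (`Admissible.trace_scaled_le`).

These losses are absorbed by the potential `Φ = (σ + 2 d u) exp (4 (d/ρ) η u)`, where `η` is updated
to `(1 + u)² η`, a quality bound valid for every choice of directions. Under the smallness
assumption `η u` falls by at least a fixed multiple of `u` at each step, so the drop of the
exponential pays for the growth of the first factor (`potential_step_le`). Hence the mean of `Φ`
contracts by `ρ` per step. Finally the ratio `λ' / λ` is at most `Φ` pointwise, and `Φ ≤ 2 d η₀` at
the start. -/

noncomputable section

namespace BlockQN

/-! ### Loewner order, quadratic forms and traces -/

section LoewnerOrder

variable {n : Type*}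

/-- Cancels one factor of a squared quantity that is allowed to vanish, as needed after each use of
Cauchy–Schwarz. -/
theorem le_of_sq_le_mul {x y : ℝ} (hx : 0 ≤ x) (hy : 0 ≤ y) (h : x ^ 2 ≤ x * y) : x ≤ y := by
  rcases hx.eq_or_lt with rfl | hx
  · exact hy
  · nlinarith

theorem transpose_eq_of_posSemidef {A : Matrix n n ℝ} (hA : A.PosSemidef) : Aᵀ = A := by
  simpa [Matrix.IsHermitian, Matrix.conjTranspose_eq_transpose_of_trivial] using hA.isHermitian

theorem posDef_of_le {A B : Matrix n n ℝ} (hA : A.PosDef) (h : A ≤ B) : B.PosDef := by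
  have := hA.add_posSemidef (Matrix.le_iff.1 h)
  rwa [add_sub_cancel] at this

theorem smul_mono {A B : Matrix n n ℝ} (h : A ≤ B) {c : ℝ} (hc : 0 ≤ c) : c • A ≤ c • B := by
  rw [Matrix.le_iff, ← smul_sub]
  exact (Matrix.le_iff.1 h).smul hc

theorem smul_le_smul_of_posSemidef {A : Matrix n n ℝ} (hA : A.PosSemidef) {c c' : ℝ}
    (h : c ≤ c') : c • A ≤ c' • A := by
  rw [Matrix.le_iff, ← sub_smul]
  exact hA.smul (sub_nonneg.2 h)

variable [Fintype n]

theorem quadForm_nonneg {A : Matrix n n ℝ} (hA : A.PosSemidef) (x : n → ℝ) :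
    0 ≤ x ⬝ᵥ (A *ᵥ x) := by
  simpa using hA.dotProduct_mulVec_nonneg x

theorem posSemidef_of_quadForm {A : Matrix n n ℝ} (hA : Aᵀ = A)
    (h : ∀ x, 0 ≤ x ⬝ᵥ (A *ᵥ x)) : A.PosSemidef :=
  .of_dotProduct_mulVec_nonneg
    (by rwa [Matrix.IsHermitian, Matrix.conjTranspose_eq_transpose_of_trivial])
    (by simpa using h)

theorem quadForm_mono {A B : Matrix n n ℝ} (h : A ≤ B) (x : n → ℝ) :
    x ⬝ᵥ (A *ᵥ x) ≤ x ⬝ᵥ (B *ᵥ x) := by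
  have := quadForm_nonneg (Matrix.le_iff.1 h) x
  rwa [Matrix.sub_mulVec, dotProduct_sub, sub_nonneg] at this

theorem le_of_quadForm {A B : Matrix n n ℝ} (hA : Aᵀ = A) (hB : Bᵀ = B)
    (h : ∀ x, x ⬝ᵥ (A *ᵥ x) ≤ x ⬝ᵥ (B *ᵥ x)) : A ≤ B := by
  refine Matrix.le_iff.2 (posSemidef_of_quadForm (by simp [hA, hB]) fun x => ?_)
  rw [Matrix.sub_mulVec, dotProduct_sub, sub_nonneg]
  exact h x

theorem bilin_comm {A : Matrix n n ℝ} (hA : Aᵀ = A) (x y : n → ℝ) :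
    x ⬝ᵥ (A *ᵥ y) = y ⬝ᵥ (A *ᵥ x) := by
  conv_rhs => rw [Matrix.dotProduct_mulVec, ← Matrix.mulVec_transpose, hA, dotProduct_comm]

theorem bilin_cauchy_schwarz {A : Matrix n n ℝ} (hA : A.PosSemidef) (x y : n → ℝ) :
    (x ⬝ᵥ (A *ᵥ y)) ^ 2 ≤ (x ⬝ᵥ (A *ᵥ x)) * (y ⬝ᵥ (A *ᵥ y)) := by
  have h : ∀ t : ℝ, 0 ≤ (y ⬝ᵥ (A *ᵥ y)) * (t * t) + (2 * (x ⬝ᵥ (A *ᵥ y))) * t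
      + x ⬝ᵥ (A *ᵥ x) := by
    intro t
    have := quadForm_nonneg hA (x + t • y)
    simp only [Matrix.mulVec_add, Matrix.mulVec_smul, dotProduct_add, add_dotProduct,
      smul_dotProduct, dotProduct_smul, smul_eq_mul,
      bilin_comm (transpose_eq_of_posSemidef hA) y x] at this
    linarith
  have := discrim_le_zero h
  rw [discrim] at this
  linarith

variable [DecidableEq n]

theorem mul_inv_of_posDef {A : Matrix n n ℝ} (hA : A.PosDef) : A * A⁻¹ = 1 :=
  Matrix.mul_nonsing_inv _ ((Matrix.isUnit_iff_isUnit_det A).1 hA.isUnit)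

theorem inv_mul_of_posDef {A : Matrix n n ℝ} (hA : A.PosDef) : A⁻¹ * A = 1 :=
  Matrix.nonsing_inv_mul _ ((Matrix.isUnit_iff_isUnit_det A).1 hA.isUnit)

theorem mulVec_inv_mulVec {A : Matrix n n ℝ} (hA : A.PosDef) (x : n → ℝ) :
    A *ᵥ (A⁻¹ *ᵥ x) = x := by
  rw [Matrix.mulVec_mulVec, mul_inv_of_posDef hA, Matrix.one_mulVec]

theorem inv_mulVec_mulVec {A : Matrix n n ℝ} (hA : A.PosDef) (x : n → ℝ) :
    A⁻¹ *ᵥ (A *ᵥ x) = x := by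
  rw [Matrix.mulVec_mulVec, inv_mul_of_posDef hA, Matrix.one_mulVec]

theorem dual_cauchy_schwarz {A : Matrix n n ℝ} (hA : A.PosDef) (g w : n → ℝ) :
    (g ⬝ᵥ w) ^ 2 ≤ (g ⬝ᵥ (A⁻¹ *ᵥ g)) * (w ⬝ᵥ (A *ᵥ w)) := by
  have h := bilin_cauchy_schwarz hA.posSemidef (A⁻¹ *ᵥ g) w
  have e : (A⁻¹ *ᵥ g) ⬝ᵥ (A *ᵥ w) = g ⬝ᵥ w := by
    rw [bilin_comm (transpose_eq_of_posSemidef hA.posSemidef), mulVec_inv_mulVec hA,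
      dotProduct_comm]
  rw [e, mulVec_inv_mulVec hA, dotProduct_comm (A⁻¹ *ᵥ g)] at h
  exact h

theorem inv_le_smul_inv {A B : Matrix n n ℝ} (hA : A.PosDef) (hB : B.PosDef) {c : ℝ} (hc : 0 ≤ c)
    (h : A ≤ c • B) : B⁻¹ ≤ c • A⁻¹ := by
  refine le_of_quadForm (transpose_eq_of_posSemidef hB.inv.posSemidef)
    (by rw [Matrix.transpose_smul, transpose_eq_of_posSemidef hA.inv.posSemidef]) fun g => ?_
  have h1 := dual_cauchy_schwarz hA g (B⁻¹ *ᵥ g)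
  have h2 := quadForm_mono h (B⁻¹ *ᵥ g)
  rw [Matrix.smul_mulVec, mulVec_inv_mulVec hB, dotProduct_smul, smul_eq_mul,
    dotProduct_comm (B⁻¹ *ᵥ g) g] at h2
  rw [Matrix.smul_mulVec, dotProduct_smul, smul_eq_mul]
  have h3 := quadForm_nonneg hA.inv.posSemidef g
  have h4 := quadForm_nonneg hB.inv.posSemidef g
  refine le_of_sq_le_mul h4 (by positivity) (h1.trans ?_)
  nlinarith [mul_le_mul_of_nonneg_left h2 h3]

theorem exists_eq_transpose_mul_self {A : Matrix n n ℝ} (hA : A.PosSemidef) :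
    ∃ B : Matrix n n ℝ, A = Bᵀ * B := by
  obtain ⟨X, hX, -, rfl⟩ :=
    CFC.exists_sqrt_of_isSelfAdjoint_of_quasispectrumRestricts hA.isHermitian
      (QuasispectrumRestricts.nnreal_of_nonneg hA.nonneg)
  refine ⟨X, ?_⟩
  have : Xᵀ = X := by
    rw [← Matrix.conjTranspose_eq_transpose_of_trivial]; exact hX.star_eq
  rw [this]

theorem trace_mul_nonneg {A B : Matrix n n ℝ} (hA : A.PosSemidef) (hB : B.PosSemidef) :
    0 ≤ (A * B).trace := by
  obtain ⟨C, rfl⟩ := exists_eq_transpose_mul_self hB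
  rw [← Matrix.mul_assoc, Matrix.trace_mul_comm, ← Matrix.mul_assoc]
  have := hA.mul_mul_conjTranspose_same C
  rw [Matrix.conjTranspose_eq_transpose_of_trivial] at this
  exact this.trace_nonneg

theorem trace_mul_mono_left {A B C : Matrix n n ℝ} (h : A ≤ B) (hC : C.PosSemidef) :
    (A * C).trace ≤ (B * C).trace := by
  have := trace_mul_nonneg (Matrix.le_iff.1 h) hC
  rwa [Matrix.sub_mul, Matrix.trace_sub, sub_nonneg] at this

theorem trace_mul_mono_right {A B C : Matrix n n ℝ} (hC : C.PosSemidef) (h : A ≤ B) :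
    (C * A).trace ≤ (C * B).trace := by
  rw [Matrix.trace_mul_comm C, Matrix.trace_mul_comm C]
  exact trace_mul_mono_left h hC

/-- A positive semidefinite matrix is bounded by its trace relative to a positive definite one. -/
theorem le_trace_inv_mul_smul {H N : Matrix n n ℝ} (hH : H.PosDef) (hN : N.PosSemidef) :
    N ≤ (H⁻¹ * N).trace • H := by
  have hHt := transpose_eq_of_posSemidef hH.posSemidef
  refine le_of_quadForm (transpose_eq_of_posSemidef hN)
    (by rw [Matrix.transpose_smul, hHt]) fun w => ?_
  -- With `N = Cᵀ C`, the form of `N` is the sum of `(C i ⬝ᵥ w)²` over the rows of `C`, and the dual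
  -- Cauchy–Schwarz inequality is applied row by row; the dual norms add up to the trace.
  obtain ⟨C, rfl⟩ := exists_eq_transpose_mul_self hN
  have e1 : w ⬝ᵥ ((Cᵀ * C) *ᵥ w) = ∑ i, (C i ⬝ᵥ w) ^ 2 := by
    rw [← Matrix.mulVec_mulVec, Matrix.dotProduct_mulVec, Matrix.vecMul_transpose]
    simp [dotProduct, Matrix.mulVec, sq]
  have e2 : (H⁻¹ * (Cᵀ * C)).trace = ∑ i, C i ⬝ᵥ (H⁻¹ *ᵥ C i) := by
    rw [← Matrix.mul_assoc, Matrix.trace_mul_comm, Matrix.trace]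
    refine Finset.sum_congr rfl fun i _ => ?_
    rw [Matrix.diag_apply, Matrix.mul_apply]
    rfl
  rw [e1, Matrix.smul_mulVec, dotProduct_smul, smul_eq_mul, e2, Finset.sum_mul]
  exact Finset.sum_le_sum fun i _ => dual_cauchy_schwarz hH _ _

/-- If `H ≤ G ≤ η H`, then `G` approximates `H` up to a relative error `1 - 1/η`, measured in
the norm dual to that of `H`. -/
theorem quadForm_inv_residual_le {H G : Matrix n n ℝ} {η : ℝ} (hH : H.PosDef) (hη : 1 ≤ η)
    (h1 : H ≤ G) (h2 : G ≤ η • H) (g : n → ℝ) :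
    (g - H *ᵥ (G⁻¹ *ᵥ g)) ⬝ᵥ (H⁻¹ *ᵥ (g - H *ᵥ (G⁻¹ *ᵥ g))) ≤
      (1 - 1 / η) ^ 2 * (g ⬝ᵥ (H⁻¹ *ᵥ g)) := by
  have hG := posDef_of_le hH h1
  have hη0 : 0 < η := by linarith
  have hc : 0 ≤ 1 - 1 / η := by
    rw [sub_nonneg, div_le_one hη0]; exact hη
  have hGinv : G⁻¹ ≤ H⁻¹ := by
    have := inv_le_smul_inv hH hG zero_le_one (by simpa using h1)
    simpa using this
  have hHinv : H⁻¹ ≤ η • G⁻¹ := inv_le_smul_inv hG hH hη0.le h2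
  -- The residual is `H D g`, with `0 ≤ D ≤ (1 - 1/η) H⁻¹`. Its squared dual norm is the `D`-pairing
  -- of `H D g` with `g`; Cauchy–Schwarz for `D` bounds the square of that number by a multiple of
  -- itself, and one factor cancels.
  obtain ⟨D, hD⟩ : ∃ D, D = H⁻¹ - G⁻¹ := ⟨_, rfl⟩
  have hDpos : D.PosSemidef := hD ▸ Matrix.le_iff.1 hGinv
  have hDle : ∀ w, w ⬝ᵥ (D *ᵥ w) ≤ (1 - 1 / η) * (w ⬝ᵥ (H⁻¹ *ᵥ w)) := by
    intro w
    have h := quadForm_mono hHinv w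
    rw [Matrix.smul_mulVec, dotProduct_smul, smul_eq_mul] at h
    rw [hD, Matrix.sub_mulVec, dotProduct_sub]
    have : (1 / η) * (w ⬝ᵥ (H⁻¹ *ᵥ w)) ≤ w ⬝ᵥ (G⁻¹ *ᵥ w) := by
      rw [one_div, inv_mul_le_iff₀ hη0]; exact h
    linarith
  have e1 : g - H *ᵥ (G⁻¹ *ᵥ g) = H *ᵥ (D *ᵥ g) := by
    rw [hD, Matrix.sub_mulVec, Matrix.mulVec_sub, mulVec_inv_mulVec hH]
  have e2 : H⁻¹ *ᵥ (H *ᵥ (D *ᵥ g)) = D *ᵥ g := inv_mulVec_mulVec hH _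
  rw [e1, e2]
  have h3 := bilin_cauchy_schwarz hDpos (H *ᵥ (D *ᵥ g)) g
  have h4 := hDle (H *ᵥ (D *ᵥ g))
  rw [e2] at h4
  have h5 := hDle g
  have h6 : 0 ≤ (H *ᵥ (D *ᵥ g)) ⬝ᵥ (D *ᵥ g) := by
    rw [dotProduct_comm]; exact quadForm_nonneg hH.posSemidef _
  have h7 := quadForm_nonneg hDpos g
  have h8 := quadForm_nonneg hH.inv.posSemidef g
  refine le_of_sq_le_mul h6 (by positivity) (h3.trans ?_)
  calc _ ≤ ((1 - 1 / η) * ((H *ᵥ (D *ᵥ g)) ⬝ᵥ (D *ᵥ g))) *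
        ((1 - 1 / η) * (g ⬝ᵥ (H⁻¹ *ᵥ g))) :=
        mul_le_mul h4 h5 h7 (by positivity)
    _ = _ := by ring

theorem quadForm_inv_step_le {H G : Matrix n n ℝ} (hH : H.PosDef) (h : H ≤ G) (g : n → ℝ) :
    (G⁻¹ *ᵥ g) ⬝ᵥ (H *ᵥ (G⁻¹ *ᵥ g)) ≤ g ⬝ᵥ (H⁻¹ *ᵥ g) := by
  have hG := posDef_of_le hH h
  have hGinv : G⁻¹ ≤ H⁻¹ := by
    have := inv_le_smul_inv hH hG zero_le_one (by simpa using h)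
    simpa using this
  refine (quadForm_mono h _).trans ?_
  rw [mulVec_inv_mulVec hG, dotProduct_comm]
  exact quadForm_mono hGinv g

end LoewnerOrder

/-! ### Block BFGS and DFP updates: order bounds and trace decrease -/

section BlockUpdate

variable {d k : ℕ}

/-- `U (Uᵀ A U)⁻¹ Uᵀ`, the inverse of `A` compressed to the column space of `U`. -/
def sketchInv (A : Matrix (Fin d) (Fin d) ℝ) (U : Matrix (Fin d) (Fin k) ℝ) :
    Matrix (Fin d) (Fin d) ℝ :=
  U * (Uᵀ * A * U)⁻¹ * Uᵀ

/-- For rank-deficient `U` the Gram matrix is singular and its formal inverse is `0`. The identities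
below therefore hold for every `U`, and the order bounds on the estimators need no exceptional null
set. -/
theorem gram_inv_eq_zero {U : Matrix (Fin d) (Fin k) ℝ} (hU : ¬ Function.Injective U.mulVec)
    (A : Matrix (Fin d) (Fin d) ℝ) : (Uᵀ * A * U)⁻¹ = 0 := by
  refine Matrix.nonsing_inv_apply_not_isUnit _ fun h => hU ?_
  have hinj := Matrix.mulVec_injective_iff_isUnit.2 ((Matrix.isUnit_iff_isUnit_det _).2 h)
  intro x y hxy
  refine hinj ?_
  simp only [← Matrix.mulVec_mulVec]
  rw [hxy]

theorem gram_posDef {U : Matrix (Fin d) (Fin k) ℝ} (hU : Function.Injective U.mulVec)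
    {A : Matrix (Fin d) (Fin d) ℝ} (hA : A.PosDef) : (Uᵀ * A * U).PosDef := by
  simpa only [Matrix.conjTranspose_eq_transpose_of_trivial] using hA.conjTranspose_mul_mul_same hU

theorem sketchInv_posSemidef {A : Matrix (Fin d) (Fin d) ℝ} (hA : A.PosDef)
    (U : Matrix (Fin d) (Fin k) ℝ) : (sketchInv A U).PosSemidef := by
  have h := hA.posSemidef.conjTranspose_mul_mul_same U
  rw [Matrix.conjTranspose_eq_transpose_of_trivial] at h
  have h' := h.inv.mul_mul_conjTranspose_same U
  rw [Matrix.conjTranspose_eq_transpose_of_trivial] at h'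
  exact h'

theorem sketchInv_mul_mul_sketchInv {A B G : Matrix (Fin d) (Fin d) ℝ}
    {U : Matrix (Fin d) (Fin k) ℝ}
    (h : ((Uᵀ * A * U)⁻¹ * (Uᵀ * B * U)) * (Uᵀ * G * U)⁻¹ = (Uᵀ * G * U)⁻¹) :
    sketchInv A U * B * sketchInv G U = sketchInv G U := by
  calc _ = U * (((Uᵀ * A * U)⁻¹ * (Uᵀ * B * U)) * (Uᵀ * G * U)⁻¹) * Uᵀ := by
        simp only [sketchInv, Matrix.mul_assoc]
    _ = _ := by rw [h, sketchInv]

/-- `sketchInv A U * A` is the `A`-orthogonal projection onto the range of `U` when `U` is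
injective, and it fixes the columns of `sketchInv G U`. Otherwise both sides are `0`. -/
theorem sketchInv_mul_mul_left {A : Matrix (Fin d) (Fin d) ℝ} (hA : A.PosDef)
    (G : Matrix (Fin d) (Fin d) ℝ) (U : Matrix (Fin d) (Fin k) ℝ) :
    sketchInv A U * A * sketchInv G U = sketchInv G U := by
  refine sketchInv_mul_mul_sketchInv ?_
  by_cases hU : Function.Injective U.mulVec
  · rw [inv_mul_of_posDef (gram_posDef hU hA), Matrix.one_mul]
  · simp [gram_inv_eq_zero hU]

theorem sketchInv_mul_mul_right {A : Matrix (Fin d) (Fin d) ℝ} (hA : A.PosDef)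
    (G : Matrix (Fin d) (Fin d) ℝ) (U : Matrix (Fin d) (Fin k) ℝ) :
    sketchInv G U * A * sketchInv A U = sketchInv G U := by
  by_cases hU : Function.Injective U.mulVec
  · calc _ = U * ((Uᵀ * G * U)⁻¹ * ((Uᵀ * A * U) * (Uᵀ * A * U)⁻¹)) * Uᵀ := by
          simp only [sketchInv, Matrix.mul_assoc]
      _ = _ := by rw [mul_inv_of_posDef (gram_posDef hU hA), Matrix.mul_one, sketchInv]
  · simp [sketchInv, gram_inv_eq_zero hU]

theorem blockBFGS_eq (G A : Matrix (Fin d) (Fin d) ℝ) (U : Matrix (Fin d) (Fin k) ℝ) :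
    blockBFGS G A U = G - G * sketchInv G U * G + A * sketchInv A U * A := by
  simp only [blockBFGS, sketchInv, Matrix.mul_assoc]

theorem blockDFP_eq (G A : Matrix (Fin d) (Fin d) ℝ) (U : Matrix (Fin d) (Fin k) ℝ) :
    blockDFP G A U = A * sketchInv A U * A
      + (1 - A * sketchInv A U) * G * (1 - sketchInv A U * A) := by
  simp only [blockDFP, sketchInv, Matrix.mul_assoc]

theorem conj_posSemidef {N : Matrix (Fin d) (Fin d) ℝ} (hN : N.PosSemidef)
    {X Y : Matrix (Fin d) (Fin d) ℝ} (h : Yᵀ = X) : (X * N * Y).PosSemidef := by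
  subst h
  simpa only [Matrix.conjTranspose_eq_transpose_of_trivial] using hN.conjTranspose_mul_mul_same Y

theorem blockBFGS_le_blockDFP {G A : Matrix (Fin d) (Fin d) ℝ} (hG : G.PosDef) (hA : A.PosDef)
    (U : Matrix (Fin d) (Fin k) ℝ) : blockBFGS G A U ≤ blockDFP G A U := by
  have h1 := sketchInv_mul_mul_left hG (G := G) (U := U)
  have h2 := sketchInv_mul_mul_left hG (G := A) (U := U)
  have h3 := sketchInv_mul_mul_right hG (G := A) (U := U)
  have tV := transpose_eq_of_posSemidef (sketchInv_posSemidef hG U)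
  have tW := transpose_eq_of_posSemidef (sketchInv_posSemidef hA U)
  have tG := transpose_eq_of_posSemidef hG.posSemidef
  have tA := transpose_eq_of_posSemidef hA.posSemidef
  rw [Matrix.le_iff, blockBFGS_eq, blockDFP_eq]
  generalize sketchInv G U = V at *
  generalize sketchInv A U = W at *
  -- The difference of the two updates is a congruence of `G`, hence positive semidefinite.
  have key : A * W * A + (1 - A * W) * G * (1 - W * A) - (G - G * V * G + A * W * A) =
      (G * V - A * W) * G * (V * G - W * A) := by
    have e1 : G * V * G * (V * G) = G * (V * G * V) * G := by noncomm_ring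
    have e2 : G * V * G * (W * A) = G * (V * G * W) * A := by noncomm_ring
    have e3 : A * W * G * (V * G) = A * (W * G * V) * G := by noncomm_ring
    simp only [sub_mul, mul_sub, one_mul, mul_one, e1, e2, e3, h1, h2, h3]
    simp only [mul_assoc]
    abel
  rw [key]
  exact conj_posSemidef hG.posSemidef (by simp [Matrix.transpose_mul, tV, tW, tG, tA])

theorem le_blockBFGS {G A : Matrix (Fin d) (Fin d) ℝ} (hA : A.PosDef) (h : A ≤ G)
    (U : Matrix (Fin d) (Fin k) ℝ) : A ≤ blockBFGS G A U := by
  have hG := posDef_of_le hA h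
  have h1 := sketchInv_mul_mul_left hG (G := G) (U := U)
  have h2 := sketchInv_mul_mul_left hA (G := A) (U := U)
  have h3 := sketchInv_mul_mul_left hA (G := G) (U := U)
  have h4 := sketchInv_mul_mul_right hA (G := G) (U := U)
  have tV := transpose_eq_of_posSemidef (sketchInv_posSemidef hG U)
  have tW := transpose_eq_of_posSemidef (sketchInv_posSemidef hA U)
  have tG := transpose_eq_of_posSemidef hG.posSemidef
  have tA := transpose_eq_of_posSemidef hA.posSemidef
  rw [Matrix.le_iff, blockBFGS_eq]
  generalize sketchInv G U = V at *
  generalize sketchInv A U = W at *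
  -- The excess over `A` splits into a congruence of `G - A` and a congruence of `A`.
  have key : G - G * V * G + A * W * A - A =
      (1 - G * V) * (G - A) * (1 - V * G) + (G * V - A * W) * A * (V * G - W * A) := by
    have e1 : G * V * G * (V * G) = G * (V * G * V) * G := by noncomm_ring
    have e2 : G * V * A * (W * A) = G * (V * A * W) * A := by noncomm_ring
    have e3 : A * W * A * (V * G) = A * (W * A * V) * G := by noncomm_ring
    have e4 : A * W * A * (W * A) = A * (W * A * W) * A := by noncomm_ring
    simp only [sub_mul, mul_sub, one_mul, mul_one, e1, e2, e3, e4, h1, h2, h3, h4]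
    simp only [mul_assoc]
    abel
  rw [key]
  exact (conj_posSemidef (Matrix.le_iff.1 h) (by simp [Matrix.transpose_mul, tV, tG])).add
    (conj_posSemidef hA.posSemidef (by simp [Matrix.transpose_mul, tV, tW, tG, tA]))

theorem blockDFP_le {G A : Matrix (Fin d) (Fin d) ℝ} {η : ℝ} (hA : A.PosDef) (hη : 1 ≤ η)
    (h : G ≤ η • A) (U : Matrix (Fin d) (Fin k) ℝ) : blockDFP G A U ≤ η • A := by
  have h2 := sketchInv_mul_mul_left hA (G := A) (U := U)
  have hW := sketchInv_posSemidef hA U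
  have tW := transpose_eq_of_posSemidef hW
  have tA := transpose_eq_of_posSemidef hA.posSemidef
  rw [Matrix.le_iff, blockDFP_eq]
  generalize sketchInv A U = W at *
  -- The term `A W A` is kept with weight `1 ≤ η`, and the rest is a congruence of `η A - G`.
  have key : η • A - (A * W * A + (1 - A * W) * G * (1 - W * A)) =
      (η - 1) • (A * W * A) + (1 - A * W) * (η • A - G) * (1 - W * A) := by
    have e4 : A * W * A * (W * A) = A * (W * A * W) * A := by noncomm_ring
    simp only [sub_mul, mul_sub, one_mul, mul_one, smul_mul_assoc, mul_smul_comm, e4, h2, sub_smul,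
      one_smul, smul_sub]
    simp only [mul_assoc]
    abel
  rw [key]
  exact ((conj_posSemidef hW tA).smul (sub_nonneg.2 hη)).add
    (conj_posSemidef (Matrix.le_iff.1 h) (by simp [Matrix.transpose_mul, tW, tA]))

/-- `blockDFP G A U - A` is the congruence of `G - A` by the complementary projection `1 - W A`.
Moving that factor cyclically inside the trace turns `A⁻¹` into `A⁻¹ - W`. -/
theorem trace_blockDFP {A : Matrix (Fin d) (Fin d) ℝ} (hA : A.PosDef)
    (G : Matrix (Fin d) (Fin d) ℝ) (U : Matrix (Fin d) (Fin k) ℝ) :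
    (A⁻¹ * (blockDFP G A U - A)).trace =
      (A⁻¹ * (G - A)).trace - (sketchInv A U * (G - A)).trace := by
  have h2 := sketchInv_mul_mul_left hA (G := A) (U := U)
  have hi := inv_mul_of_posDef hA
  rw [blockDFP_eq]
  generalize sketchInv A U = W at *
  have key : A⁻¹ * (A * W * A + (1 - A * W) * G * (1 - W * A) - A) =
      (A⁻¹ * (1 - A * W) * (G - A)) * (1 - W * A) := by
    have e : (1 - A * W) * (G - A) * (1 - W * A) = (1 - A * W) * G * (1 - W * A)
        - A + A * W * A + A * W * A - A * (W * A * W) * A := by noncomm_ring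
    rw [mul_assoc A⁻¹, mul_assoc A⁻¹, e, h2]
    congr 1
    abel
  have e : (1 - W * A) * (A⁻¹ * (1 - A * W)) = A⁻¹ - W := by
    have e1 : (1 - W * A) * (A⁻¹ * (1 - A * W)) =
        A⁻¹ - A⁻¹ * A * W - W * (A * A⁻¹) + W * (A * A⁻¹) * A * W := by noncomm_ring
    rw [e1, hi, mul_inv_of_posDef hA, one_mul, mul_one, h2]
    abel
  rw [key, Matrix.trace_mul_comm, ← mul_assoc, e, sub_mul, Matrix.trace_sub]

/-- Replaces the `A`-dependent sketch by the orthogonal projection, whose Gaussian mean is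
computable. Compressing `A ≤ L I` to the range of `U` and inverting reverses the order. -/
theorem sketchInv_one_le {A : Matrix (Fin d) (Fin d) ℝ} (hA : A.PosDef) {L : ℝ} (hL : 0 ≤ L)
    (h : A ≤ L • 1) (U : Matrix (Fin d) (Fin k) ℝ) : sketchInv 1 U ≤ L • sketchInv A U := by
  have hone : (1 : Matrix (Fin d) (Fin d) ℝ).PosDef := .one
  by_cases hU : Function.Injective U.mulVec
  · have h1 : Uᵀ * A * U ≤ L • (Uᵀ * (1 : Matrix (Fin d) (Fin d) ℝ) * U) := by
      have := (Matrix.le_iff.1 h).conjTranspose_mul_mul_same U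
      rw [Matrix.conjTranspose_eq_transpose_of_trivial] at this
      rw [Matrix.le_iff]
      convert this using 1
      simp [Matrix.mul_sub, Matrix.sub_mul]
    have h2 := inv_le_smul_inv (gram_posDef hU hA) (gram_posDef hU hone) hL h1
    have h3 := (Matrix.le_iff.1 h2).mul_mul_conjTranspose_same U
    rw [Matrix.conjTranspose_eq_transpose_of_trivial] at h3
    rw [Matrix.le_iff]
    convert h3 using 1
    simp [sketchInv, Matrix.mul_sub, Matrix.sub_mul]
  · simp only [sketchInv, gram_inv_eq_zero hU, Matrix.mul_zero, Matrix.zero_mul, smul_zero,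
      le_refl]

variable (v : Variant) {G A : Matrix (Fin d) (Fin d) ℝ}

theorem Variant.le_update (hA : A.PosDef) (h : A ≤ G) (U : Matrix (Fin d) (Fin k) ℝ) :
    A ≤ v.update G A U := by
  cases v
  · exact le_blockBFGS hA h U
  · exact (le_blockBFGS hA h U).trans (blockBFGS_le_blockDFP (posDef_of_le hA h) hA U)

theorem Variant.update_le_blockDFP (hA : A.PosDef) (h : A ≤ G) (U : Matrix (Fin d) (Fin k) ℝ) :
    v.update G A U ≤ blockDFP G A U := by
  cases v
  · exact blockBFGS_le_blockDFP (posDef_of_le hA h) hA U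
  · exact le_rfl

theorem Variant.update_le {η : ℝ} (hA : A.PosDef) (hη : 1 ≤ η) (h : A ≤ G) (h' : G ≤ η • A)
    (U : Matrix (Fin d) (Fin k) ℝ) : v.update G A U ≤ η • A :=
  (v.update_le_blockDFP hA h U).trans (blockDFP_le hA hη h' U)

theorem Variant.trace_update_le {L : ℝ} (hA : A.PosDef) (h : A ≤ G) (hL : 0 < L)
    (hAL : A ≤ L • 1) (U : Matrix (Fin d) (Fin k) ℝ) :
    (A⁻¹ * (v.update G A U - A)).trace ≤
      (A⁻¹ * (G - A)).trace - L⁻¹ * (sketchInv 1 U * (G - A)).trace := by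
  refine (trace_mul_mono_right hA.inv.posSemidef
    (sub_le_sub_right (v.update_le_blockDFP hA h U) A)).trans ?_
  rw [trace_blockDFP hA]
  have := trace_mul_mono_left (sketchInv_one_le hA hL.le hAL U) (Matrix.le_iff.1 h)
  rw [smul_mul_assoc, Matrix.trace_smul, smul_eq_mul] at this
  have h2 := (inv_mul_le_iff₀ hL).2 this
  linarith

end BlockUpdate

/-! ### Measurability of matrix operations -/

section MatrixMeasurability

variable {m n l α : Type*} [MeasurableSpace α]

instance : MeasurableSpace (Matrix m n ℝ) := inferInstanceAs (MeasurableSpace (m → n → ℝ))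

instance [Countable m] [Countable n] : BorelSpace (Matrix m n ℝ) :=
  inferInstanceAs (BorelSpace (m → n → ℝ))

theorem measurable_matrix_iff {f : α → Matrix m n ℝ} :
    Measurable f ↔ ∀ i j, Measurable fun a => f a i j := by
  refine (measurable_pi_iff (X := fun _ : m => n → ℝ)).trans (forall_congr' fun i => ?_)
  exact measurable_pi_iff

theorem measurable_matrix_mul [Fintype n] {f : α → Matrix m n ℝ} {g : α → Matrix n l ℝ}
    (hf : Measurable f) (hg : Measurable g) : Measurable fun a => f a * g a := by
  rw [measurable_matrix_iff] at *
  intro i j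
  simp only [Matrix.mul_apply]
  exact Finset.measurable_sum _ fun x _ => (hf i x).mul (hg x j)

theorem measurable_matrix_add {f g : α → Matrix m n ℝ}
    (hf : Measurable f) (hg : Measurable g) : Measurable fun a => f a + g a := by
  rw [measurable_matrix_iff] at *
  exact fun i j => (hf i j).add (hg i j)

theorem measurable_matrix_sub {f g : α → Matrix m n ℝ}
    (hf : Measurable f) (hg : Measurable g) : Measurable fun a => f a - g a := by
  rw [measurable_matrix_iff] at *
  exact fun i j => (hf i j).sub (hg i j)

theorem measurable_matrix_smul {c : α → ℝ} {f : α → Matrix m n ℝ}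
    (hc : Measurable c) (hf : Measurable f) : Measurable fun a => c a • f a := by
  rw [measurable_matrix_iff] at *
  exact fun i j => hc.mul (hf i j)

theorem measurable_matrix_transpose {f : α → Matrix m n ℝ} (hf : Measurable f) :
    Measurable fun a => (f a)ᵀ := by
  rw [measurable_matrix_iff] at *
  exact fun i j => hf j i

theorem measurable_matrix_trace [Fintype n] {f : α → Matrix n n ℝ} (hf : Measurable f) :
    Measurable fun a => (f a).trace := by
  rw [measurable_matrix_iff] at hf
  exact Finset.measurable_sum _ fun i _ => hf i i

theorem measurable_matrix_mulVec [Fintype n] {f : α → Matrix m n ℝ} {g : α → n → ℝ}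
    (hf : Measurable f) (hg : Measurable g) : Measurable fun a => f a *ᵥ g a := by
  rw [measurable_matrix_iff] at hf
  rw [measurable_pi_iff] at *
  exact fun i => Finset.measurable_sum _ fun x _ => (hf i x).mul (hg x)

theorem measurable_dotProduct [Fintype n] {f g : α → n → ℝ}
    (hf : Measurable f) (hg : Measurable g) : Measurable fun a => f a ⬝ᵥ g a := by
  rw [measurable_pi_iff] at *
  exact Finset.measurable_sum _ fun x _ => (hf x).mul (hg x)

theorem measurable_matrix_inv [Fintype n] [DecidableEq n] {f : α → Matrix n n ℝ}
    (hf : Measurable f) : Measurable fun a => (f a)⁻¹ := by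
  simp only [Matrix.inv_def, Ring.inverse_eq_inv']
  refine measurable_matrix_smul (Measurable.inv ?_) ?_
  · exact (Continuous.measurable (f := fun A : Matrix n n ℝ => A.det)
      (continuous_id.matrix_det)).comp hf
  · exact (Continuous.measurable (f := fun A : Matrix n n ℝ => A.adjugate)
      (continuous_id.matrix_adjugate)).comp hf

end MatrixMeasurability

/-! ### Zero sets of polynomials under atomless product measures -/

section PolynomialZeros

/-- Induction with Fubini: view `p` as a polynomial in the first variable. For almost all values of
the other variables its leading coefficient is nonzero, so only finitely many values of the first
are roots, and these have measure zero. -/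
theorem ae_eval_ne_zero_fin (ν : Measure ℝ) [IsProbabilityMeasure ν] [NullSingletonClass ν]
    {n : ℕ} (p : MvPolynomial (Fin n) ℝ) (hp : p ≠ 0) :
    ∀ᵐ x ∂(Measure.pi fun _ : Fin n => ν), MvPolynomial.eval x p ≠ 0 := by
  induction n with
  | zero =>
    refine Filter.Eventually.of_forall fun x h => hp ?_
    rw [MvPolynomial.eq_C_of_isEmpty p] at h ⊢
    rw [MvPolynomial.eval_C] at h
    rw [h, map_zero]
  | succ n ih =>
    have hq : MvPolynomial.finSuccEquiv ℝ n p ≠ 0 := by simpa using hp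
    have h1 := ih _ (Polynomial.leadingCoeff_ne_zero.2 hq)
    have hmeas : MeasurableSet {z : ℝ × (Fin n → ℝ) |
        MvPolynomial.eval (Fin.cons z.1 z.2 : Fin (n + 1) → ℝ) p ≠ 0} := by
      have hc : Continuous fun z : ℝ × (Fin n → ℝ) => (Fin.cons z.1 z.2 : Fin (n + 1) → ℝ) :=
        Continuous.finCons (A := fun _ => ℝ) continuous_fst continuous_snd
      exact (isClosed_singleton.preimage
        ((MvPolynomial.continuous_eval p).comp hc)).measurableSet.compl
    have h2 : ∀ᵐ z ∂(ν.prod (Measure.pi fun _ : Fin n => ν)),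
        MvPolynomial.eval (Fin.cons z.1 z.2 : Fin (n + 1) → ℝ) p ≠ 0 := by
      refine (Measure.ae_prod_mem_iff_ae_ae_mem hmeas).2 ?_
      refine (Measure.ae_ae_comm hmeas).2 ?_
      filter_upwards [h1] with y hy
      have hne : Polynomial.map (MvPolynomial.eval y) (MvPolynomial.finSuccEquiv ℝ n p) ≠ 0 := by
        intro h0
        have := congrArg (fun r => Polynomial.coeff r
          (MvPolynomial.finSuccEquiv ℝ n p).natDegree) h0
        simp only [Polynomial.coeff_map, Polynomial.coeff_zero] at this
        exact hy this
      have hfin := Polynomial.finite_setOfPred_isRoot hne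
      have h0 := hfin.measure_zero ν
      rw [ae_iff]
      refine measure_mono_null ?_ h0
      intro x hx
      simp only [Set.mem_ofPred_eq, not_not] at hx ⊢
      rw [Polynomial.IsRoot, ← MvPolynomial.eval_eq_eval_mv_eval']
      exact hx
    have hmp := measurePreserving_piFinSuccAbove (fun _ : Fin (n + 1) => ν) 0
    have h3 := hmp.quasiMeasurePreserving.ae h2
    filter_upwards [h3] with x hx
    convert hx using 3
    exact (Fin.cons_self_tail x).symm

/-- A nonzero polynomial does not vanish almost surely at independent atomless coordinates. -/
theorem ae_eval_ne_zero (ν : Measure ℝ) [IsProbabilityMeasure ν] [NullSingletonClass ν]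
    {ι : Type*} [Fintype ι] (p : MvPolynomial ι ℝ) (hp : p ≠ 0) :
    ∀ᵐ x ∂(Measure.pi fun _ : ι => ν), MvPolynomial.eval x p ≠ 0 := by
  have e := Fintype.equivFin ι
  have h1 := ae_eval_ne_zero_fin ν (MvPolynomial.rename e p)
    ((map_ne_zero_iff _ (MvPolynomial.rename_injective e e.injective)).2 hp)
  have hmp := measurePreserving_piCongrLeft (fun _ : Fin (Fintype.card ι) => ν) e
  filter_upwards [hmp.quasiMeasurePreserving.ae h1] with x hx
  rw [MvPolynomial.eval_rename] at hx
  convert hx using 3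
  ext i
  simp [MeasurableEquiv.piCongrLeft, Equiv.piCongrLeft_apply_apply]

end PolynomialZeros

/-! ### Mean of the projection onto a Gaussian column space -/

section GaussianSketch

variable {d k : ℕ}

/-- The law of a `d × k` array of independent standard normal variables. -/
def gaussianArray (d k : ℕ) : Measure (Fin d × Fin k → ℝ) :=
  Measure.pi fun _ => gaussianReal 0 1

instance : IsProbabilityMeasure (gaussianArray d k) := by
  unfold gaussianArray; infer_instance

/-- The matrix with the given entries. -/
def arrayMatrix (x : Fin d × Fin k → ℝ) : Matrix (Fin d) (Fin k) ℝ :=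
  Matrix.of fun i j => x (i, j)

theorem measurable_arrayMatrix : Measurable (arrayMatrix (d := d) (k := k)) :=
  measurable_matrix_iff.2 fun i j => measurable_pi_apply (i, j)

theorem ae_injective_arrayMatrix (h : k ≤ d) :
    ∀ᵐ x ∂gaussianArray d k, Function.Injective (arrayMatrix x).mulVec := by
  let X : Matrix (Fin d) (Fin k) (MvPolynomial (Fin d × Fin k) ℝ) :=
    Matrix.of fun i j => MvPolynomial.X (i, j)
  have heval : ∀ x, MvPolynomial.eval x (Xᵀ * X).det
      = ((arrayMatrix x)ᵀ * arrayMatrix x).det := by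
    intro x
    rw [RingHom.map_det]
    congr 1
    ext i j
    simp [X, Matrix.mul_apply, arrayMatrix]
  have hne : (Xᵀ * X).det ≠ 0 := by
    intro h0
    -- The Gram determinant is not the zero polynomial: it equals `1` at the coordinate embedding.
    have h1 := heval fun p => if p.1 = Fin.castLE h p.2 then 1 else 0
    have h2 : ∀ J : Matrix (Fin d) (Fin k) ℝ,
        J = Matrix.of (fun i j => if i = Fin.castLE h j then (1 : ℝ) else 0) → Jᵀ * J = 1 := by
      rintro J rfl
      ext i j
      simp [Matrix.mul_apply, Matrix.one_apply, eq_comm]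
    rw [h0, map_zero, h2 (arrayMatrix _) rfl, Matrix.det_one] at h1
    exact zero_ne_one h1
  have : NullSingletonClass (gaussianReal 0 1) := nullSingletonClass_gaussianReal one_ne_zero
  filter_upwards [ae_eval_ne_zero (gaussianReal 0 1) _ hne] with x hx
  rw [heval] at hx
  have hu := Matrix.mulVec_injective_iff_isUnit.2
    ((Matrix.isUnit_iff_isUnit_det _).2 (isUnit_iff_ne_zero.2 hx))
  intro y z hyz
  refine hu ?_
  simp only [← Matrix.mulVec_mulVec]
  rw [hyz]

/-- The orthogonal projection onto the column space of `U`. -/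
abbrev colProj (U : Matrix (Fin d) (Fin k) ℝ) : Matrix (Fin d) (Fin d) ℝ := sketchInv 1 U

theorem colProj_transpose (U : Matrix (Fin d) (Fin k) ℝ) : (colProj U)ᵀ = colProj U :=
  transpose_eq_of_posSemidef (sketchInv_posSemidef .one U)

theorem colProj_mul_self (U : Matrix (Fin d) (Fin k) ℝ) : colProj U * colProj U = colProj U := by
  simpa using sketchInv_mul_mul_left Matrix.PosDef.one 1 U

theorem abs_colProj_le_one (U : Matrix (Fin d) (Fin k) ℝ) (i j : Fin d) : |colProj U i j| ≤ 1 := by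
  -- Symmetry and idempotence make each diagonal entry the sum of squares of its row, so every
  -- squared entry is at most the diagonal one, which is itself at most `1`.
  have h : colProj U i i = ∑ j, colProj U i j ^ 2 := by
    conv_lhs => rw [← colProj_mul_self U, Matrix.mul_apply]
    refine Finset.sum_congr rfl fun j _ => ?_
    rw [sq]
    congr 1
    exact congrFun (congrFun (colProj_transpose U) i) j
  have hle : ∀ j, colProj U i j ^ 2 ≤ colProj U i i := fun j => by
    rw [h]
    exact Finset.single_le_sum (f := fun j => colProj U i j ^ 2) (fun _ _ => sq_nonneg _)
      (Finset.mem_univ j)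
  have h1 := hle i
  have h2 := hle j
  rw [← sq_le_one_iff_abs_le_one]
  nlinarith

theorem trace_colProj {U : Matrix (Fin d) (Fin k) ℝ} (hU : Function.Injective U.mulVec) :
    (colProj U).trace = k := by
  have h := inv_mul_of_posDef (gram_posDef hU (Matrix.PosDef.one (n := Fin d) (R := ℝ)))
  rw [colProj, sketchInv, Matrix.trace_mul_comm, ← Matrix.mul_assoc]
  have e : Uᵀ * U = Uᵀ * (1 : Matrix (Fin d) (Fin d) ℝ) * U := by rw [Matrix.mul_one]
  rw [e, Matrix.trace_mul_comm, h, Matrix.trace_one, Fintype.card_fin]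

theorem colProj_orthogonal_mul {Q : Matrix (Fin d) (Fin d) ℝ} (hQ : Qᵀ * Q = 1)
    (U : Matrix (Fin d) (Fin k) ℝ) : colProj (Q * U) = Q * colProj U * Qᵀ := by
  have e : (Q * U)ᵀ * (1 : Matrix (Fin d) (Fin d) ℝ) * (Q * U) =
      Uᵀ * (1 : Matrix (Fin d) (Fin d) ℝ) * U := by
    rw [Matrix.transpose_mul, Matrix.mul_one, Matrix.mul_one, Matrix.mul_assoc,
      ← Matrix.mul_assoc Qᵀ, hQ, Matrix.one_mul]
  unfold colProj sketchInv
  rw [e, Matrix.transpose_mul]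
  simp only [Matrix.mul_assoc]

theorem colProj_submatrix (U : Matrix (Fin d) (Fin k) ℝ) (e : Equiv.Perm (Fin d)) :
    colProj (U.submatrix e id) = (colProj U).submatrix e e := by
  have h : (U.submatrix e id)ᵀ * (1 : Matrix (Fin d) (Fin d) ℝ) * (U.submatrix e id)
      = Uᵀ * (1 : Matrix (Fin d) (Fin d) ℝ) * U := by
    rw [Matrix.mul_one, Matrix.mul_one, Matrix.transpose_submatrix, Matrix.submatrix_mul_equiv,
      Matrix.submatrix_id_id]
  unfold colProj sketchInv
  rw [h]
  ext i j
  simp [Matrix.mul_apply]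

theorem measurable_sketchInv {α : Type*} [MeasurableSpace α] {A : α → Matrix (Fin d) (Fin d) ℝ}
    {U : α → Matrix (Fin d) (Fin k) ℝ} (hA : Measurable A) (hU : Measurable U) :
    Measurable fun a => sketchInv (A a) (U a) :=
  measurable_matrix_mul (measurable_matrix_mul hU (measurable_matrix_inv
    (measurable_matrix_mul (measurable_matrix_mul (measurable_matrix_transpose hU) hA) hU)))
    (measurable_matrix_transpose hU)

theorem integrable_colProj (i j : Fin d) :
    Integrable (fun x => colProj (arrayMatrix x) i j) (gaussianArray d k) := by
  refine Integrable.of_bound (C := 1) ?_ (Filter.Eventually.of_forall fun x => ?_)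
  · exact (measurable_matrix_iff.1
      (measurable_sketchInv measurable_const measurable_arrayMatrix) i j).aestronglyMeasurable
  · rw [Real.norm_eq_abs]
    exact abs_colProj_le_one _ i j

/-- Flipping the sign of row `i` preserves the Gaussian law and conjugates the projection by a
diagonal sign matrix, which negates the entry `(i, j)`. -/
theorem integral_colProj_of_ne {i j : Fin d} (hij : i ≠ j) :
    ∫ x, colProj (arrayMatrix x) i j ∂(gaussianArray d k) = 0 := by
  let s : Fin d → ℝ := fun a => if a = i then -1 else 1
  have hs : ∀ a, s a * s a = 1 := fun a => by by_cases h : a = i <;> simp [s, h]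
  have hQ : (Matrix.diagonal s)ᵀ * Matrix.diagonal s = 1 := by
    rw [Matrix.diagonal_transpose, Matrix.diagonal_mul_diagonal]
    simp only [hs, Matrix.diagonal_one]
  have hmp : MeasurePreserving (fun (x : Fin d × Fin k → ℝ) p => s p.1 * x p)
      (gaussianArray d k) (gaussianArray d k) := by
    refine measurePreserving_pi _ _ fun p => ?_
    by_cases h : p.1 = i
    · refine ⟨measurable_const_mul _, ?_⟩
      simpa [s, h, funext fun x : ℝ => neg_one_mul x] using gaussianReal_map_neg (μ := 0) (v := 1)
    · refine ⟨measurable_const_mul _, ?_⟩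
      have hid : (HMul.hMul (1 : ℝ) : ℝ → ℝ) = id := funext one_mul
      simp [s, h, hid]
  have hf : ∀ x : Fin d × Fin k → ℝ,
      colProj (arrayMatrix fun p => s p.1 * x p) i j = - colProj (arrayMatrix x) i j := by
    intro x
    have e : (arrayMatrix fun p => s p.1 * x p) = Matrix.diagonal s * arrayMatrix x := by
      ext a b
      simp [arrayMatrix, Matrix.diagonal_mul]
    rw [e, colProj_orthogonal_mul hQ, Matrix.diagonal_transpose, Matrix.mul_diagonal,
      Matrix.diagonal_mul]
    simp [s, hij.symm]
  have h1 : ∫ x, colProj (arrayMatrix x) i j ∂(gaussianArray d k) =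
      ∫ x : Fin d × Fin k → ℝ, colProj (arrayMatrix fun p => s p.1 * x p) i j
        ∂(gaussianArray d k) := by
    conv_lhs => rw [← hmp.map_eq]
    refine integral_map hmp.measurable.aemeasurable ?_
    rw [hmp.map_eq]
    exact (integrable_colProj i j).1
  simp only [hf, integral_neg] at h1
  linarith

/-- Swapping rows `i` and `j` preserves the law and permutes the diagonal of the projection. -/
theorem integral_colProj_diag (i j : Fin d) :
    ∫ x, colProj (arrayMatrix x) i i ∂(gaussianArray d k) =
      ∫ x, colProj (arrayMatrix x) j j ∂(gaussianArray d k) := by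
  have hmp : MeasurePreserving
      (MeasurableEquiv.piCongrLeft (fun _ => ℝ)
        ((Equiv.swap i j).prodCongr (Equiv.refl (Fin k))))
      (gaussianArray d k) (gaussianArray d k) :=
    measurePreserving_piCongrLeft (fun _ => gaussianReal 0 1)
      ((Equiv.swap i j).prodCongr (Equiv.refl (Fin k)))
  rw [← hmp.integral_comp' (fun x => colProj (arrayMatrix x) i i)]
  congr 1
  ext x
  have e : arrayMatrix (MeasurableEquiv.piCongrLeft (fun _ => ℝ)
        ((Equiv.swap i j).prodCongr (Equiv.refl (Fin k))) x)
      = (arrayMatrix x).submatrix (Equiv.swap i j) id := by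
    ext a b
    obtain ⟨a, rfl⟩ := (Equiv.swap i j).surjective a
    have := Equiv.piCongrLeft_apply_apply (fun _ => ℝ)
      ((Equiv.swap i j).prodCongr (Equiv.refl (Fin k))) x (a, b)
    simpa [arrayMatrix, MeasurableEquiv.piCongrLeft] using this
  rw [e, colProj_submatrix, Matrix.submatrix_apply, Equiv.swap_apply_left]

/-- The mean projection is a multiple of the identity by the two symmetries. The multiple is `k / d`
because the projection almost surely has trace `k`. -/
theorem integral_trace_colProj_mul (h : k ≤ d) (N : Matrix (Fin d) (Fin d) ℝ) :
    ∫ x, (colProj (arrayMatrix x) * N).trace ∂(gaussianArray d k) = (k : ℝ) / d * N.trace := by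
  have hint : ∀ i j, Integrable (fun x => colProj (arrayMatrix x) i j * N j i)
      (gaussianArray d k) := fun i j => (integrable_colProj i j).mul_const _
  have h1 : ∫ x, (colProj (arrayMatrix x) * N).trace ∂(gaussianArray d k) =
      ∑ i, (∫ x, colProj (arrayMatrix x) i i ∂(gaussianArray d k)) * N i i := by
    simp only [Matrix.trace, Matrix.diag_apply, Matrix.mul_apply]
    rw [integral_finsetSum _ fun i _ => integrable_finsetSum _ fun j _ => hint i j]
    refine Finset.sum_congr rfl fun i _ => ?_
    rw [integral_finsetSum _ fun j _ => hint i j]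
    simp only [integral_mul_const]
    rw [Finset.sum_eq_single i]
    · intro j _ hj
      rw [integral_colProj_of_ne hj.symm, zero_mul]
    · simp
  have h2 : ∑ i, ∫ x, colProj (arrayMatrix x) i i ∂(gaussianArray d k) = k := by
    rw [← integral_finsetSum _ fun i _ => integrable_colProj i i]
    rw [integral_congr_ae (g := fun _ => (k : ℝ))]
    · simp
    · filter_upwards [ae_injective_arrayMatrix h] with x hx
      exact trace_colProj hx
  rw [h1]
  rcases Nat.eq_zero_or_pos d with rfl | hd
  · simp
  · have hd' : (d : ℝ) ≠ 0 := by positivity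
    have h3 : ∀ i, ∫ x, colProj (arrayMatrix x) i i ∂(gaussianArray d k) = (k : ℝ) / d := by
      intro i
      rw [eq_div_iff hd', ← h2, Finset.sum_congr rfl fun j _ => integral_colProj_diag j i]
      simp [mul_comm]
    simp only [h3, ← Finset.mul_sum]
    rfl

end GaussianSketch

/-- A twice differentiable, `L`-smooth, `μ`-strongly convex and `M`-strongly self-concordant
function. -/
structure IsRegular {d : ℕ} (f : EuclideanSpace ℝ (Fin d) → ℝ) (L μ M : ℝ) : Prop where
  twice : TwiceDifferentiable f
  smooth : IsSmoothWith L f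
  pos : 0 < μ
  conv : StrongConvexOn Set.univ μ f
  nonneg : 0 ≤ M
  selfConcordant : StronglySelfConcordant M f

/-! ### Hessian bounds and one quasi-Newton step -/

section Calculus

variable {d : ℕ} {f : EuclideanSpace ℝ (Fin d) → ℝ} {L μ M : ℝ}

theorem hess_mulVec (f : EuclideanSpace ℝ (Fin d) → ℝ) (x v : EuclideanSpace ℝ (Fin d)) :
    hess f x *ᵥ v.ofLp = (fderiv ℝ (gradient f) x v).ofLp := by
  have hv : v = ∑ j, v j • EuclideanSpace.single j (1 : ℝ) := by
    ext i
    simp [Pi.single_apply]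
  ext i
  conv_rhs => rw [hv, map_sum]
  simp [hess, Matrix.mulVec, dotProduct, mul_comm]

theorem inner_eq_dotProduct (x y : EuclideanSpace ℝ (Fin d)) : inner ℝ x y = x.ofLp ⬝ᵥ y.ofLp := by
  rw [EuclideanSpace.inner_eq_star_dotProduct, star_trivial, dotProduct_comm]

theorem bilin_hess (f : EuclideanSpace ℝ (Fin d) → ℝ) (x v w : EuclideanSpace ℝ (Fin d)) :
    w.ofLp ⬝ᵥ (hess f x *ᵥ v.ofLp) = inner ℝ w (fderiv ℝ (gradient f) x v) := by
  rw [hess_mulVec, inner_eq_dotProduct]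

/-- Symmetry of the second derivative at a point needs only that the gradient exists everywhere and
is differentiable at that point; continuity of the Hessian is not assumed. -/
theorem hess_transpose (hf : TwiceDifferentiable f) (x : EuclideanSpace ℝ (Fin d)) :
    (hess f x)ᵀ = hess f x := by
  let B : EuclideanSpace ℝ (Fin d) →L[ℝ] EuclideanSpace ℝ (Fin d) →L[ℝ] ℝ :=
    isBoundedBilinearMap_inner.toContinuousLinearMap
  have h1 : ∀ y, HasFDerivAt f (B (gradient f y)) y := by
    intro y
    exact (hf.1 y).hasGradientAt.hasFDerivAt.congr_fderiv (by ext v; rfl)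
  have h2 : HasFDerivAt (fun y => B (gradient f y)) (B ∘L fderiv ℝ (gradient f) x) x :=
    B.hasFDerivAt.comp x (hf.2 x).hasFDerivAt
  have h3 := second_derivative_symmetric h1 h2
  ext i j
  have h4 := h3 (EuclideanSpace.single i 1) (EuclideanSpace.single j 1)
  have hB : ∀ v w, B v w = inner ℝ v w := fun v w => rfl
  simp only [ContinuousLinearMap.comp_apply, hB] at h4
  simpa [hess, EuclideanSpace.inner_single_right] using h4

theorem hasDerivAt_gradient_line (hf : TwiceDifferentiable f) (x v w : EuclideanSpace ℝ (Fin d))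
    (t : ℝ) : HasDerivAt (fun s : ℝ => inner ℝ w (gradient f (x + s • v)))
      (inner ℝ w (fderiv ℝ (gradient f) (x + t • v) v)) t := by
  have h1 : HasDerivAt (fun s : ℝ => x + s • v) v t := by
    simpa using ((hasDerivAt_id t).smul_const v).const_add x
  have h2 := (hf.2 (x + t • v)).hasFDerivAt.comp_hasDerivAt t h1
  simpa using (hasDerivAt_const t w).inner ℝ h2

theorem quadForm_hess_ge (hf : TwiceDifferentiable f) (hc : StrongConvexOn Set.univ μ f)
    (x v : EuclideanSpace ℝ (Fin d)) :
    μ * inner ℝ v v ≤ inner ℝ v (fderiv ℝ (gradient f) x v) := by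
  have hg := strongConvexOn_iff_convex.1 hc
  have hline : ∀ t : ℝ, HasDerivAt (fun s : ℝ => x + s • v) v t := fun t => by
    simpa using ((hasDerivAt_id t).smul_const v).const_add x
  -- On a line, `f - (μ/2)‖·‖²` is convex, so its derivative is monotone, and the derivative of that
  -- derivative at `0` is nonnegative.
  have hφ : ConvexOn ℝ Set.univ fun t : ℝ => f (x + t • v) - μ / 2 * ‖x + t • v‖ ^ 2 := by
    have := hg.comp_affineMap (AffineMap.lineMap x (x + v))
    simpa [Function.comp_def, AffineMap.lineMap_apply, add_comm] using this
  have hd : ∀ t : ℝ, HasDerivAt (fun t : ℝ => f (x + t • v) - μ / 2 * ‖x + t • v‖ ^ 2)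
      (inner ℝ v (gradient f (x + t • v)) - μ * inner ℝ v (x + t • v)) t := by
    intro t
    have h1 := (hf.1 (x + t • v)).hasGradientAt.hasFDerivAt.comp_hasDerivAt t (hline t)
    have h2 := ((hline t).norm_sq).const_mul (μ / 2)
    refine (h1.sub h2).congr_deriv ?_
    rw [InnerProductSpace.toDual_apply_apply, real_inner_comm v, real_inner_comm v]
    ring
  have hmono : Monotone fun t : ℝ =>
      inner ℝ v (gradient f (x + t • v)) - μ * inner ℝ v (x + t • v) := by
    have := hφ.monotoneOn_deriv fun t _ => (hd t).differentiableAt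
    rw [funext fun t => (hd t).deriv] at this
    exact monotoneOn_univ.1 this
  have hd2 : HasDerivAt (fun t : ℝ =>
      inner ℝ v (gradient f (x + t • v)) - μ * inner ℝ v (x + t • v))
      (inner ℝ v (fderiv ℝ (gradient f) (x + (0 : ℝ) • v) v) - μ * inner ℝ v v) 0 := by
    have h := hasDerivAt_gradient_line hf x v v 0
    have h2 := ((hasDerivAt_const (0 : ℝ) v).inner ℝ (hline 0)).const_mul μ
    refine (h.sub h2).congr_deriv ?_
    simp
  have := hmono.deriv_nonneg (x := 0)
  rw [hd2.deriv, zero_smul, add_zero] at this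
  linarith

theorem quadForm_hess_le (hf : TwiceDifferentiable f) (hL : IsSmoothWith L f)
    (x v : EuclideanSpace ℝ (Fin d)) :
    inner ℝ v (fderiv ℝ (gradient f) x v) ≤ L * inner ℝ v v := by
  rcases eq_or_ne v 0 with rfl | hv
  · simp
  have hL0 : 0 ≤ L := by
    have := (norm_nonneg _).trans (hL v 0)
    rw [sub_zero] at this
    exact nonneg_of_mul_nonneg_left this (norm_pos_iff.2 hv)
  have h1 : ‖fderiv ℝ (gradient f) x‖ ≤ (⟨L, hL0⟩ : NNReal) := by
    refine (hf.2 x).hasFDerivAt.le_of_lipschitz (LipschitzWith.of_dist_le_mul fun y z => ?_)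
    rw [dist_eq_norm, dist_eq_norm]
    exact hL y z
  calc inner ℝ v (fderiv ℝ (gradient f) x v) ≤ ‖v‖ * ‖fderiv ℝ (gradient f) x v‖ :=
        real_inner_le_norm _ _
    _ ≤ ‖v‖ * (L * ‖v‖) := by
        gcongr
        exact (ContinuousLinearMap.le_opNorm _ _).trans
          (mul_le_mul_of_nonneg_right h1 (norm_nonneg _))
    _ = L * inner ℝ v v := by rw [real_inner_self_eq_norm_sq]; ring

theorem IsRegular.smul_one_le_hess (hf : IsRegular f L μ M) (x : EuclideanSpace ℝ (Fin d)) :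
    μ • (1 : Matrix (Fin d) (Fin d) ℝ) ≤ hess f x := by
  refine le_of_quadForm (by simp) (hess_transpose hf.twice x) fun v => ?_
  have := quadForm_hess_ge hf.twice hf.conv x (WithLp.toLp 2 v)
  rw [← bilin_hess, inner_eq_dotProduct] at this
  simpa [Matrix.smul_mulVec] using this

theorem IsRegular.hess_le_smul_one (hf : IsRegular f L μ M) (x : EuclideanSpace ℝ (Fin d)) :
    hess f x ≤ L • (1 : Matrix (Fin d) (Fin d) ℝ) := by
  refine le_of_quadForm (hess_transpose hf.twice x) (by simp) fun v => ?_
  have := quadForm_hess_le hf.twice hf.smooth x (WithLp.toLp 2 v)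
  rw [← bilin_hess, inner_eq_dotProduct] at this
  simpa [Matrix.smul_mulVec] using this

theorem IsRegular.hess_posDef (hf : IsRegular f L μ M) (x : EuclideanSpace ℝ (Fin d)) :
    (hess f x).PosDef :=
  posDef_of_le (Matrix.PosDef.one.smul hf.pos) (hf.smul_one_le_hess x)

theorem IsRegular.le_of_pos (hf : IsRegular f L μ M) (hd : 0 < d) : μ ≤ L := by
  have h := (hf.smul_one_le_hess 0).trans (hf.hess_le_smul_one 0)
  have := (Matrix.le_iff.1 h).diag_nonneg (i := ⟨0, hd⟩)
  simpa using this

theorem wnorm_nonneg (A : Matrix (Fin d) (Fin d) ℝ) (v : EuclideanSpace ℝ (Fin d)) :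
    0 ≤ wnorm A v := Real.sqrt_nonneg _

theorem wnorm_sq {A : Matrix (Fin d) (Fin d) ℝ} (hA : A.PosSemidef)
    (v : EuclideanSpace ℝ (Fin d)) : wnorm A v ^ 2 = v.ofLp ⬝ᵥ (A *ᵥ v.ofLp) :=
  Real.sq_sqrt (quadForm_nonneg hA _)

theorem wnorm_smul (A : Matrix (Fin d) (Fin d) ℝ) (c : ℝ) (v : EuclideanSpace ℝ (Fin d)) :
    wnorm A (c • v) = |c| * wnorm A v := by
  rw [wnorm, wnorm, ← Real.sqrt_sq_eq_abs, ← Real.sqrt_mul (sq_nonneg c)]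
  congr 1
  simp [Matrix.mulVec_smul]
  ring

theorem wnorm_neg (A : Matrix (Fin d) (Fin d) ℝ) (v : EuclideanSpace ℝ (Fin d)) :
    wnorm A (-v) = wnorm A v := by
  simpa using wnorm_smul A (-1) v

/-- Polarisation: testing `E ≤ c H` on `t w + v` and `-E ≤ c H` on `t w - v` and adding leaves a
quadratic in `t` that is nonnegative everywhere; its discriminant gives the claim. -/
theorem abs_bilin_le {E H : Matrix (Fin d) (Fin d) ℝ} {c : ℝ} (hc : 0 ≤ c) (hH : H.PosSemidef)
    (hE : Eᵀ = E) (h1 : E ≤ c • H) (h2 : -E ≤ c • H) (v w : EuclideanSpace ℝ (Fin d)) :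
    |w.ofLp ⬝ᵥ (E *ᵥ v.ofLp)| ≤ c * wnorm H v * wnorm H w := by
  have h : ∀ t : ℝ, 0 ≤ (c * (w.ofLp ⬝ᵥ (H *ᵥ w.ofLp))) * (t * t)
      + (-2 * (w.ofLp ⬝ᵥ (E *ᵥ v.ofLp))) * t + c * (v.ofLp ⬝ᵥ (H *ᵥ v.ofLp)) := by
    intro t
    have ha := quadForm_mono h1 (t • w.ofLp + v.ofLp)
    have hb := quadForm_mono h2 (t • w.ofLp - v.ofLp)
    simp only [Matrix.mulVec_add, Matrix.mulVec_sub, Matrix.mulVec_smul, dotProduct_add,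
      add_dotProduct, dotProduct_sub, sub_dotProduct, Matrix.smul_mulVec, Matrix.neg_mulVec,
      smul_dotProduct, dotProduct_smul, smul_eq_mul, dotProduct_neg,
      bilin_comm hE v.ofLp w.ofLp] at ha hb
    linarith
  have hd := discrim_le_zero h
  rw [discrim] at hd
  refine abs_le_of_sq_le_sq ?_ (mul_nonneg (mul_nonneg hc (wnorm_nonneg _ _)) (wnorm_nonneg _ _))
  rw [mul_pow, mul_pow, wnorm_sq hH, wnorm_sq hH]
  linarith

theorem IsRegular.hess_sub_le (hf : IsRegular f L μ M) (x y w : EuclideanSpace ℝ (Fin d)) :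
    hess f y - hess f x ≤ (M * wnorm (hess f x) (y - x)) • hess f w :=
  hf.selfConcordant x y w x

/-- Strong self-concordance leaves the base point of the local norm free, so exchanging `x` and `y`
can keep the norm at `x`. -/
theorem IsRegular.hess_sub_le' (hf : IsRegular f L μ M) (x y w : EuclideanSpace ℝ (Fin d)) :
    hess f x - hess f y ≤ (M * wnorm (hess f x) (y - x)) • hess f w := by
  have := hf.selfConcordant y x w x
  rwa [← neg_sub y x, wnorm_neg] at this

theorem IsRegular.hess_le (hf : IsRegular f L μ M) (x y : EuclideanSpace ℝ (Fin d)) :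
    hess f y ≤ (1 + M * wnorm (hess f x) (y - x)) • hess f x := by
  rw [add_smul, one_smul, ← sub_le_iff_le_add']
  exact hf.hess_sub_le x y x

theorem IsRegular.hess_le' (hf : IsRegular f L μ M) (x y : EuclideanSpace ℝ (Fin d)) :
    hess f x ≤ (1 + M * wnorm (hess f x) (y - x)) • hess f y := by
  rw [add_smul, one_smul, ← sub_le_iff_le_add']
  exact hf.hess_sub_le' x y y

/-- Second order expansion of the gradient of a strongly self-concordant function. -/
theorem IsRegular.abs_gradient_sub_le (hf : IsRegular f L μ M)
    (x p w : EuclideanSpace ℝ (Fin d)) :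
    |inner ℝ w (gradient f (x + p)) - inner ℝ w (gradient f x)
        - inner ℝ w (fderiv ℝ (gradient f) x p)| ≤
      M * wnorm (hess f x) p ^ 2 / 2 * wnorm (hess f x) w := by
  let φ : ℝ → ℝ := fun s => inner ℝ w (gradient f (x + s • p)) - inner ℝ w (gradient f x)
    - s * inner ℝ w (fderiv ℝ (gradient f) x p)
  have hφ : ∀ s, HasDerivAt φ (inner ℝ w (fderiv ℝ (gradient f) (x + s • p) p)
      - inner ℝ w (fderiv ℝ (gradient f) x p)) s := by
    intro s
    refine (((hasDerivAt_gradient_line hf.twice x p w s).sub_const _).sub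
      ((hasDerivAt_id s).mul_const _)).congr_deriv ?_
    simp
  let K := M * wnorm (hess f x) p ^ 2 * wnorm (hess f x) w
  have hB : ∀ s : ℝ, HasDerivAt (fun s : ℝ => K / 2 * s ^ 2) (K * s) s := by
    intro s
    refine ((hasDerivAt_pow 2 s).const_mul (K / 2)).congr_deriv ?_
    norm_num
    ring
  -- The remainder along the segment has derivative at most `K s` in absolute value, so comparison
  -- with `K s² / 2` replaces integrating the Hessian.
  have key := image_norm_le_of_norm_deriv_right_le_deriv_boundary' (a := 0) (b := 1)
    (fun s _ => (hφ s).continuousAt.continuousWithinAt) (fun s _ => (hφ s).hasDerivWithinAt)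
    (B := fun s => K / 2 * s ^ 2) (B' := fun s => K * s) (by simp [φ])
    (fun s _ => (hB s).continuousAt.continuousWithinAt) (fun s _ => (hB s).hasDerivWithinAt)
    (fun s hs => ?_) (x := 1) (by simp)
  · simp only [φ, Real.norm_eq_abs, one_smul, one_mul] at key
    refine key.trans (le_of_eq ?_)
    simp only [K]
    ring
  · have hs0 : 0 ≤ s := hs.1
    have h1 := hf.hess_sub_le x (x + s • p) x
    have h2 := hf.hess_sub_le' x (x + s • p) x
    rw [add_sub_cancel_left, wnorm_smul, abs_of_nonneg hs0] at h1 h2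
    have h3 := abs_bilin_le (mul_nonneg hf.nonneg (mul_nonneg hs0 (wnorm_nonneg _ _)))
      (hf.hess_posDef x).posSemidef (by simp [hess_transpose hf.twice]) h1 (by rwa [neg_sub]) p w
    rw [Matrix.sub_mulVec, dotProduct_sub, bilin_hess, bilin_hess] at h3
    rw [Real.norm_eq_abs]
    refine h3.trans (le_of_eq ?_)
    simp only [K]
    ring

theorem inner_le_wnorm_mul_wnorm {A : Matrix (Fin d) (Fin d) ℝ} (hA : A.PosDef)
    (g w : EuclideanSpace ℝ (Fin d)) : inner ℝ w g ≤ wnorm A⁻¹ g * wnorm A w := by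
  refine le_of_abs_le (abs_le_of_sq_le_sq ?_ (mul_nonneg (wnorm_nonneg _ _) (wnorm_nonneg _ _)))
  rw [mul_pow, wnorm_sq hA.inv.posSemidef, wnorm_sq hA.posSemidef, inner_eq_dotProduct,
    dotProduct_comm]
  exact dual_cauchy_schwarz hA _ _

/-- Duality: the test vector `A⁻¹ g` attains the dual norm. -/
theorem wnorm_inv_le {A : Matrix (Fin d) (Fin d) ℝ} (hA : A.PosDef) {g : EuclideanSpace ℝ (Fin d)}
    {c : ℝ} (hc : 0 ≤ c) (h : ∀ w, inner ℝ w g ≤ c * wnorm A w) : wnorm A⁻¹ g ≤ c := by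
  have h1 := h (WithLp.toLp 2 (A⁻¹ *ᵥ g.ofLp))
  have e1 : inner ℝ (WithLp.toLp 2 (A⁻¹ *ᵥ g.ofLp)) g = wnorm A⁻¹ g ^ 2 := by
    rw [wnorm_sq hA.inv.posSemidef, inner_eq_dotProduct, dotProduct_comm]
  have e2 : wnorm A (WithLp.toLp 2 (A⁻¹ *ᵥ g.ofLp)) = wnorm A⁻¹ g := by
    rw [wnorm, wnorm]
    dsimp only
    rw [mulVec_inv_mulVec hA, dotProduct_comm]
  rw [e1, e2] at h1
  refine le_of_sq_le_mul (wnorm_nonneg _ _) hc (h1.trans (le_of_eq (mul_comm _ _)))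

theorem wnorm_le_of_le_smul {A B : Matrix (Fin d) (Fin d) ℝ} {c : ℝ} (hB : B.PosSemidef)
    (hc : 0 ≤ c) (h : A ≤ (1 + c) • B) (v : EuclideanSpace ℝ (Fin d)) :
    wnorm A v ≤ (1 + c / 2) * wnorm B v := by
  refine Real.sqrt_le_iff.2 ⟨mul_nonneg (by positivity) (wnorm_nonneg _ _), ?_⟩
  have h1 := quadForm_mono h v.ofLp
  rw [Matrix.smul_mulVec, dotProduct_smul, smul_eq_mul, ← wnorm_sq hB] at h1
  nlinarith [mul_nonneg (sq_nonneg c) (sq_nonneg (wnorm B v))]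

theorem localGradNorm_nonneg (f : EuclideanSpace ℝ (Fin d) → ℝ) (x : EuclideanSpace ℝ (Fin d)) :
    0 ≤ localGradNorm f x := wnorm_nonneg _ _

theorem IsRegular.wnorm_step_le (hf : IsRegular f L μ M) {x : EuclideanSpace ℝ (Fin d)}
    {G : Matrix (Fin d) (Fin d) ℝ} (hG : hess f x ≤ G) :
    wnorm (hess f x) (nextPoint f x G - x) ≤ localGradNorm f x := by
  have e : nextPoint f x G - x = -WithLp.toLp 2 (G⁻¹ *ᵥ (gradient f x).ofLp) := by
    rw [nextPoint]; abel
  rw [e, wnorm_neg]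
  exact Real.sqrt_le_sqrt (quadForm_inv_step_le (hf.hess_posDef x) hG _)

/-- One quasi-Newton step with an estimator `H ≤ G ≤ η H` of the Hessian `H`. -/
theorem IsRegular.localGradNorm_nextPoint_le (hf : IsRegular f L μ M)
    {x : EuclideanSpace ℝ (Fin d)} {G : Matrix (Fin d) (Fin d) ℝ} {η : ℝ} (hη : 1 ≤ η)
    (hG : hess f x ≤ G) (hG' : G ≤ η • hess f x) :
    localGradNorm f (nextPoint f x G) ≤ localGradNorm f x *
      ((1 + M * localGradNorm f x / 2) * (1 - 1 / η + M * localGradNorm f x / 2)) := by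
  have hH := hf.hess_posDef x
  obtain ⟨p, hp⟩ : ∃ p, p = nextPoint f x G - x := ⟨_, rfl⟩
  have hy : nextPoint f x G = x + p := by rw [hp]; abel
  have hr := hf.wnorm_step_le hG
  rw [← hp] at hr
  have hle := hf.hess_le' x (nextPoint f x G)
  rw [← hp] at hle
  have hc : 0 ≤ 1 - 1 / η := by
    rw [sub_nonneg, div_le_one (by linarith)]; exact hη
  have hM := hf.nonneg
  obtain ⟨l, hl⟩ : ∃ l, l = localGradNorm f x := ⟨_, rfl⟩
  have hl0 : 0 ≤ l := hl ▸ localGradNorm_nonneg f x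
  have hr0 := wnorm_nonneg (hess f x) p
  rw [← hl] at hr ⊢
  refine wnorm_inv_le (hf.hess_posDef _) (by positivity) fun w => ?_
  -- The new gradient is the linear model `∇f(x) + H p`, nonzero only because `G` differs from `H`,
  -- plus a second-order remainder. Both are bounded in the norm dual to `H`; passing to the Hessian
  -- at the new point costs the factor `1 + M λ / 2`.
  have hres : inner ℝ w (gradient f x + fderiv ℝ (gradient f) x p)
      ≤ (1 - 1 / η) * l * wnorm (hess f x) w := by
    refine (inner_le_wnorm_mul_wnorm hH _ w).trans
      (mul_le_mul_of_nonneg_right ?_ (wnorm_nonneg _ _))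
    refine Real.sqrt_le_iff.2 ⟨by positivity, ?_⟩
    have e : (gradient f x + fderiv ℝ (gradient f) x p).ofLp =
        (gradient f x).ofLp - hess f x *ᵥ (G⁻¹ *ᵥ (gradient f x).ofLp) := by
      have : p.ofLp = -(G⁻¹ *ᵥ (gradient f x).ofLp) := by
        rw [hp, nextPoint]; simp
      rw [WithLp.ofLp_add, ← hess_mulVec, this, Matrix.mulVec_neg, sub_eq_add_neg]
    rw [e, mul_pow, hl, localGradNorm, wnorm_sq hH.inv.posSemidef]
    exact quadForm_inv_residual_le hH hη hG hG' _
  have hrem := (abs_le.1 (hf.abs_gradient_sub_le x p w)).2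
  rw [← hy] at hrem
  rw [inner_add_right] at hres
  have hw := wnorm_le_of_le_smul (hf.hess_posDef (nextPoint f x G)).posSemidef
    (mul_nonneg hM hr0) hle w
  have hw0 := wnorm_nonneg (hess f x) w
  have hw1 := wnorm_nonneg (hess f (nextPoint f x G)) w
  have hMr : M * wnorm (hess f x) p ≤ M * l := mul_le_mul_of_nonneg_left hr hM
  have hMr2 : M * wnorm (hess f x) p ^ 2 ≤ M * l * l := by
    rw [sq, ← mul_assoc]
    exact mul_le_mul hMr hr hr0 (by positivity)
  calc inner ℝ w (gradient f (nextPoint f x G))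
      ≤ (1 - 1 / η) * l * wnorm (hess f x) w
        + M * wnorm (hess f x) p ^ 2 / 2 * wnorm (hess f x) w := by linarith
    _ ≤ (1 - 1 / η) * l * wnorm (hess f x) w + M * l * l / 2 * wnorm (hess f x) w := by gcongr
    _ = l * (1 - 1 / η + M * l / 2) * wnorm (hess f x) w := by ring
    _ ≤ l * (1 - 1 / η + M * l / 2) * ((1 + M * l / 2) * wnorm (hess f (nextPoint f x G)) w) := by
        refine mul_le_mul_of_nonneg_left (hw.trans ?_) (by positivity)
        gcongr
    _ = _ := by ring

end Calculus

/-! ### Scalar inequalities behind the potential -/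

section Potential

/-- Here `v = η u`, and `η u (1 - 1/η + u/2) = v - u + u v / 2`: the loss `u` outweighs the
second-order terms. The constant `11/16` is what `potential_step_le` needs when `σ ≥ 1/7`, since `4
· 11/16 = 1 + 2 · 7/8`. -/
theorem scaled_step_le {u v η u' : ℝ} (hη : 1 ≤ η) (hu : 0 ≤ u) (hv : v = η * u)
    (hv' : v ≤ 867 / 10000) (h : u' ≤ u * ((1 + u / 2) * (1 - 1 / η + u / 2))) :
    (1 + u) ^ 2 * η * u' ≤ v - 11 / 16 * u := by
  have huv : u ≤ v := by rw [hv]; nlinarith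
  have hη0 : η ≠ 0 := by positivity
  have h1 : (1 + u) ^ 2 * η * u' ≤ ((1 + u) ^ 2 * (1 + u / 2)) * (v - u + u * v / 2) := by
    calc (1 + u) ^ 2 * η * u' ≤ (1 + u) ^ 2 * η * (u * ((1 + u / 2) * (1 - 1 / η + u / 2))) := by
          gcongr
      _ = _ := by rw [hv]; field_simp
  have h2 : (1 + u) ^ 2 * (1 + u / 2) ≤ 1 + 27 / 10 * u := by nlinarith [mul_nonneg hu hu]
  have h3 : 0 ≤ v - u + u * v / 2 := by nlinarith
  have h4 : v - u + u * v / 2 ≤ 867 / 10000 := by nlinarith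
  have h5 := mul_le_mul_of_nonneg_right h2 h3
  nlinarith

/-- For `σ ≤ 1/7` the bound with `1 + σ` has `1 - 1/(1 + σ) ≤ 1/8`, so `η u` shrinks by a fixed
factor. -/
theorem scaled_step_le_of_small {u v η σ u' : ℝ} (hη : 1 ≤ η) (hu : 0 ≤ u) (hv : v = η * u)
    (hv' : v ≤ 867 / 10000) (hσ : 0 ≤ σ) (hσ' : σ ≤ 1 / 7)
    (h : u' ≤ u * ((1 + u / 2) * (1 - 1 / (1 + σ) + u / 2))) :
    (1 + u) ^ 2 * η * u' ≤ v / 4 := by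
  have huv : u ≤ v := by rw [hv]; nlinarith
  have h0 : 1 - 1 / (1 + σ) ≤ 1 / 8 := by
    have : 7 / 8 ≤ 1 / (1 + σ) := by rw [le_div_iff₀ (by linarith)]; linarith
    linarith
  have h2 : (1 + u) ^ 2 * (1 + u / 2) ≤ 1 + 27 / 10 * u := by nlinarith [mul_nonneg hu hu]
  have h3 : ((1 + u) ^ 2 * (1 + u / 2)) * (1 / 8 + u / 2) ≤ 1 / 4 := by nlinarith
  calc (1 + u) ^ 2 * η * u' ≤ (1 + u) ^ 2 * η * (u * ((1 + u / 2) * (1 / 8 + u / 2))) := by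
        have : u' ≤ u * ((1 + u / 2) * (1 / 8 + u / 2)) := h.trans (by gcongr)
        gcongr
    _ = v * (((1 + u) ^ 2 * (1 + u / 2)) * (1 / 8 + u / 2)) := by rw [hv]; ring
    _ ≤ v * (1 / 4) := mul_le_mul_of_nonneg_left h3 (hu.trans huv)
    _ = v / 4 := by ring

/-- Puts all growth beyond the factor `ρ` into one exponential, linear in `u`, that a drop of the
exponent of the potential can cancel. -/
theorem growth_le_exp {D ρ u θ u' c : ℝ} (hD : 2 ≤ D) (hρ : 0 < ρ) (hρ1 : ρ ≤ 1) (hu : 0 ≤ u)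
    (hθ : 0 ≤ θ) (hc : 0 ≤ c) (h : 2 * u' ≤ c * u * ((1 + u) ^ 2 * θ)) :
    ρ * ((1 + u) ^ 2 * θ) + 2 * D * u' ≤ ρ * θ * Real.exp ((1 + c) * (D / ρ) * u) := by
  have hD0 : 0 < D := by linarith
  have h1 : 2 * u ≤ D / ρ * u := by
    refine mul_le_mul_of_nonneg_right ?_ hu
    rw [le_div_iff₀ hρ]; nlinarith
  have h2 : (1 + u) ^ 2 ≤ Real.exp (D / ρ * u) := by
    calc (1 + u) ^ 2 ≤ Real.exp u ^ 2 := by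
          gcongr
          linarith [Real.add_one_le_exp u]
      _ = Real.exp (2 * u) := by rw [← Real.exp_nat_mul]; norm_num
      _ ≤ _ := Real.exp_le_exp.2 h1
  have h3 : 1 + c * (D / ρ) * u ≤ Real.exp (c * (D / ρ) * u) := by
    linarith [Real.add_one_le_exp (c * (D / ρ) * u)]
  calc ρ * ((1 + u) ^ 2 * θ) + 2 * D * u'
      ≤ ρ * ((1 + u) ^ 2 * θ) + D * (c * u * ((1 + u) ^ 2 * θ)) := by
        have := mul_le_mul_of_nonneg_left h hD0.le
        linarith
    _ = ρ * θ * ((1 + u) ^ 2 * (1 + c * (D / ρ) * u)) := by field_simp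
    _ ≤ ρ * θ * (Real.exp (D / ρ * u) * Real.exp (c * (D / ρ) * u)) := by gcongr
    _ = _ := by rw [← Real.exp_add]; congr 2; ring

theorem potential_step_le {D ρ u η σ u' : ℝ} (hD : 2 ≤ D) (hρ : 0 < ρ) (hρ1 : ρ ≤ 1) (hu : 0 ≤ u)
    (hη : 1 ≤ η) (hσ : 0 ≤ σ) (hv : η * u ≤ 867 / 10000)
    (h1 : u' ≤ u * ((1 + u / 2) * (1 - 1 / η + u / 2)))
    (h2 : u' ≤ u * ((1 + u / 2) * (1 - 1 / (1 + σ) + u / 2))) :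
    (ρ * ((1 + u) ^ 2 * (σ + 2 * D * u)) + 2 * D * u') *
        Real.exp (4 * (D / ρ) * ((1 + u) ^ 2 * η * u')) ≤
      ρ * ((σ + 2 * D * u) * Real.exp (4 * (D / ρ) * (η * u))) := by
  have hD0 : 0 < D := by linarith
  have hDρ : 0 < D / ρ := by positivity
  obtain ⟨θ, hθ⟩ : ∃ θ, θ = σ + 2 * D * u := ⟨_, rfl⟩
  have hDu : 4 * u ≤ 2 * D * u := by nlinarith
  have hθ0 : 0 ≤ θ := by rw [hθ]; nlinarith
  -- It suffices to find `c` for which the growth rate `1 + c` is covered by four times the decrease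
  -- of `η u`.
  have main : ∀ c, 0 ≤ c → 2 * u' ≤ c * u * ((1 + u) ^ 2 * θ) →
      (1 + c) * u ≤ 4 * (η * u - (1 + u) ^ 2 * η * u') →
      (ρ * ((1 + u) ^ 2 * θ) + 2 * D * u') * Real.exp (4 * (D / ρ) * ((1 + u) ^ 2 * η * u')) ≤
        ρ * (θ * Real.exp (4 * (D / ρ) * (η * u))) := by
    intro c hc ha hb
    refine (mul_le_mul_of_nonneg_right (growth_le_exp hD hρ hρ1 hu hθ0 hc ha)
      (Real.exp_pos _).le).trans ?_
    rw [mul_assoc, ← Real.exp_add, mul_assoc]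
    gcongr
    have := mul_le_mul_of_nonneg_left hb hDρ.le
    linarith
  have hu2 : 1 + u / 2 ≤ (1 + u) ^ 2 := by nlinarith
  have hfrac : 1 - 1 / (1 + σ) = σ / (1 + σ) := by
    have : 1 + σ ≠ 0 := by positivity
    field_simp
    ring
  have bound : ∀ b, 0 ≤ b → 1 - 1 / (1 + σ) + u / 2 ≤ b * θ →
      2 * u' ≤ (2 * b) * u * ((1 + u) ^ 2 * θ) := by
    intro b hb h
    calc 2 * u' ≤ 2 * (u * ((1 + u / 2) * (1 - 1 / (1 + σ) + u / 2))) := by linarith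
      _ ≤ 2 * (u * ((1 + u) ^ 2 * (b * θ))) := by
        have h0 : 0 ≤ 1 - 1 / (1 + σ) + u / 2 := by rw [hfrac]; positivity
        gcongr
      _ = _ := by ring
  rw [← hθ]
  -- For small `σ` the choice `c = 2` works because `η u` loses three quarters of its value. For
  -- large `σ` the decrease is only `11/16 u`, but `σ/(1 + σ) ≤ (7/8) σ` permits `c = 7/4`.
  rcases le_total σ (1 / 7) with hs | hs
  · refine main (2 * 1) (by norm_num) (bound 1 zero_le_one ?_) ?_
    · have : σ / (1 + σ) ≤ σ := div_le_self hσ (by linarith)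
      rw [hfrac, hθ]
      linarith
    · have := scaled_step_le_of_small hη hu rfl hv hσ hs h2
      nlinarith
  · refine main (2 * (7 / 8)) (by norm_num) (bound (7 / 8) (by norm_num) ?_) ?_
    · have : σ / (1 + σ) ≤ 7 / 8 * σ := by
        rw [div_le_iff₀ (by linarith)]
        nlinarith
      rw [hfrac, hθ]
      linarith
    · have := scaled_step_le hη hu rfl hv h1
      linarith

end Potential

/-! ### Invariant of the trajectory and one-step decrease of the potential -/

section Dynamics

variable {d k : ℕ} {f : EuclideanSpace ℝ (Fin d) → ℝ} {L μ M : ℝ}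

/-- An iterate, a Hessian estimator, and a bound on the relative quality of the estimator. -/
abbrev State (d : ℕ) := EuclideanSpace ℝ (Fin d) × Matrix (Fin d) (Fin d) ℝ × ℝ

/-- One step of the method, which also tracks the quality of the estimator. -/
def stateStep (v : Variant) (f : EuclideanSpace ℝ (Fin d) → ℝ) (M : ℝ) (s : State d)
    (U : Matrix (Fin d) (Fin k) ℝ) : State d :=
  (nextPoint f s.1 s.2.1, nextEstimator v f M s.1 s.2.1 U,
    (1 + M * localGradNorm f s.1) ^ 2 * s.2.2)

/-- The trajectory of the method, together with the quality of the estimators. -/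
def stateIterate (v : Variant) (f : EuclideanSpace ℝ (Fin d) → ℝ) (M : ℝ) (s₀ : State d)
    (U : ℕ → Matrix (Fin d) (Fin k) ℝ) : ℕ → State d
  | 0 => s₀
  | t + 1 => stateStep v f M (stateIterate v f M s₀ U t) (U t)

theorem iterate_eq_stateIterate (v : Variant) (f : EuclideanSpace ℝ (Fin d) → ℝ) (M : ℝ)
    (s₀ : State d) (U : ℕ → Matrix (Fin d) (Fin k) ℝ) (t : ℕ) :
    iterate v f M s₀.1 s₀.2.1 U t =
      ((stateIterate v f M s₀ U t).1, (stateIterate v f M s₀ U t).2.1) := by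
  induction t with
  | zero => rfl
  | succ t ih => rw [iterate, ih]; rfl

theorem stateIterate_congr (v : Variant) (f : EuclideanSpace ℝ (Fin d) → ℝ) (M : ℝ)
    (s₀ : State d) {U V : ℕ → Matrix (Fin d) (Fin k) ℝ} {t : ℕ} (h : ∀ s < t, U s = V s) :
    stateIterate v f M s₀ U t = stateIterate v f M s₀ V t := by
  induction t with
  | zero => rfl
  | succ t ih =>
    rw [stateIterate, stateIterate, ih fun s hs => h s (hs.trans (Nat.lt_succ_self t)),
      h t (Nat.lt_succ_self t)]

/-- The relative trace error of the estimator. -/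
def excess (f : EuclideanSpace ℝ (Fin d) → ℝ) (s : State d) : ℝ :=
  ((hess f s.1)⁻¹ * (s.2.1 - hess f s.1)).trace

/-- The potential that decreases on average by the factor `ρ`. -/
def potential (f : EuclideanSpace ℝ (Fin d) → ℝ) (M ρ : ℝ) (s : State d) : ℝ :=
  (excess f s + 2 * d * (M * localGradNorm f s.1)) *
    Real.exp (4 * (d / ρ) * (s.2.2 * (M * localGradNorm f s.1)))

/-- The invariant of the trajectory. -/
structure Admissible (f : EuclideanSpace ℝ (Fin d) → ℝ) (M : ℝ) (s : State d) : Prop where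
  le : hess f s.1 ≤ s.2.1
  le_smul : s.2.1 ≤ s.2.2 • hess f s.1
  one_le : 1 ≤ s.2.2
  small : s.2.2 * (M * localGradNorm f s.1) ≤ 867 / 10000

variable {s : State d}

theorem Admissible.excess_nonneg (hf : IsRegular f L μ M) (hs : Admissible f M s) :
    0 ≤ excess f s :=
  trace_mul_nonneg (hf.hess_posDef s.1).inv.posSemidef (Matrix.le_iff.1 hs.le)

theorem IsRegular.scaled_nonneg (hf : IsRegular f L μ M) (x : EuclideanSpace ℝ (Fin d)) :
    0 ≤ M * localGradNorm f x := mul_nonneg hf.nonneg (localGradNorm_nonneg f x)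

theorem Admissible.le_excess (hf : IsRegular f L μ M) (hs : Admissible f M s) :
    s.2.1 ≤ (1 + excess f s) • hess f s.1 := by
  have := le_trace_inv_mul_smul (hf.hess_posDef s.1) (Matrix.le_iff.1 hs.le)
  rw [add_smul, one_smul, ← sub_le_iff_le_add']
  exact this

theorem Admissible.localGradNorm_next_le (hf : IsRegular f L μ M) (hs : Admissible f M s) :
    localGradNorm f (nextPoint f s.1 s.2.1) ≤ localGradNorm f s.1 *
      ((1 + M * localGradNorm f s.1 / 2) *
        (1 - 1 / (1 + excess f s) + M * localGradNorm f s.1 / 2)) :=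
  hf.localGradNorm_nextPoint_le (by linarith [hs.excess_nonneg hf]) hs.le (hs.le_excess hf)

theorem Admissible.scaled_next_le (hf : IsRegular f L μ M) (hs : Admissible f M s) :
    M * localGradNorm f (nextPoint f s.1 s.2.1) ≤ M * localGradNorm f s.1 *
      ((1 + M * localGradNorm f s.1 / 2) * (1 - 1 / s.2.2 + M * localGradNorm f s.1 / 2)) := by
  rw [mul_assoc M]
  exact mul_le_mul_of_nonneg_left
    (hf.localGradNorm_nextPoint_le hs.one_le hs.le hs.le_smul) hf.nonneg

theorem Admissible.scaled_next_le' (hf : IsRegular f L μ M) (hs : Admissible f M s) :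
    M * localGradNorm f (nextPoint f s.1 s.2.1) ≤ M * localGradNorm f s.1 *
      ((1 + M * localGradNorm f s.1 / 2) *
        (1 - 1 / (1 + excess f s) + M * localGradNorm f s.1 / 2)) := by
  rw [mul_assoc M]
  exact mul_le_mul_of_nonneg_left (hs.localGradNorm_next_le hf) hf.nonneg

/-- The estimator before the update, scaled to dominate the Hessian at the next point. -/
def scaledEstimator (f : EuclideanSpace ℝ (Fin d) → ℝ) (M : ℝ) (s : State d) :
    Matrix (Fin d) (Fin d) ℝ :=
  (1 + M * wnorm (hess f s.1) (nextPoint f s.1 s.2.1 - s.1)) • s.2.1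

theorem Admissible.hess_next_le (hf : IsRegular f L μ M) (hs : Admissible f M s) :
    hess f (nextPoint f s.1 s.2.1) ≤ scaledEstimator f M s :=
  (hf.hess_le s.1 _).trans (smul_mono hs.le
    (add_nonneg zero_le_one (mul_nonneg hf.nonneg (wnorm_nonneg _ _))))

theorem Admissible.scaledEstimator_le (hf : IsRegular f L μ M) (hs : Admissible f M s) :
    scaledEstimator f M s ≤ ((1 + M * localGradNorm f s.1) ^ 2 * s.2.2) •
      hess f (nextPoint f s.1 s.2.1) := by
  have hr := mul_nonneg hf.nonneg (wnorm_nonneg (hess f s.1) (nextPoint f s.1 s.2.1 - s.1))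
  have hrl := mul_le_mul_of_nonneg_left (hf.wnorm_step_le hs.le) hf.nonneg
  have hη := hs.one_le
  have h1 := smul_mono hs.le_smul (add_nonneg zero_le_one hr)
  have h2 := smul_mono (hf.hess_le' s.1 (nextPoint f s.1 s.2.1)) (zero_le_one.trans hη)
  have h3 := smul_mono h2 (add_nonneg zero_le_one hr)
  refine (h1.trans h3).trans ?_
  rw [smul_smul, smul_smul]
  refine smul_le_smul_of_posSemidef (hf.hess_posDef _).posSemidef ?_
  calc _ = (1 + M * wnorm (hess f s.1) (nextPoint f s.1 s.2.1 - s.1)) ^ 2 * s.2.2 := by ring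
    _ ≤ _ := by gcongr

theorem Admissible.stateStep (hf : IsRegular f L μ M) (hs : Admissible f M s) (v : Variant)
    (U : Matrix (Fin d) (Fin k) ℝ) : Admissible f M (stateStep v f M s U) := by
  have hu := hf.scaled_nonneg s.1
  have hη := hs.one_le
  have hη' : 1 ≤ (1 + M * localGradNorm f s.1) ^ 2 * s.2.2 :=
    one_le_mul_of_one_le_of_one_le (one_le_pow₀ (by linarith)) hη
  refine ⟨v.le_update (hf.hess_posDef _) (hs.hess_next_le hf) U,
    v.update_le (hf.hess_posDef _) hη' (hs.hess_next_le hf) (hs.scaledEstimator_le hf) U, hη', ?_⟩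
  have := scaled_step_le hη hu rfl hs.small (hs.scaled_next_le hf)
  have h2 := hs.small
  change (1 + M * localGradNorm f s.1) ^ 2 * s.2.2
    * (M * localGradNorm f (nextPoint f s.1 s.2.1)) ≤ _
  linarith

theorem Admissible.stateIterate (hf : IsRegular f L μ M) (hs : Admissible f M s) (v : Variant)
    (U : ℕ → Matrix (Fin d) (Fin k) ℝ) (t : ℕ) : Admissible f M (stateIterate v f M s U t) := by
  induction t with
  | zero => exact hs
  | succ t ih => exact ih.stateStep hf v (U t)

theorem Admissible.potential_nonneg (hf : IsRegular f L μ M) (hs : Admissible f M s) (ρ : ℝ) :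
    0 ≤ potential f M ρ s :=
  mul_nonneg (add_nonneg (hs.excess_nonneg hf)
    (mul_nonneg (by positivity) (hf.scaled_nonneg s.1))) (Real.exp_pos _).le

theorem Admissible.ratio_le_potential (hf : IsRegular f L μ M) (hs : Admissible f M s) {ρ : ℝ}
    (hρ : 0 < ρ) (hρ1 : ρ ≤ 1) (hd : 2 ≤ d) :
    localGradNorm f (nextPoint f s.1 s.2.1) / localGradNorm f s.1 ≤ potential f M ρ s := by
  have hu := hf.scaled_nonneg s.1
  have hσ := hs.excess_nonneg hf
  have hη := hs.one_le
  have hd' : (2 : ℝ) ≤ d := by exact_mod_cast hd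
  -- This form also covers `λ = 0`, where the quotient is `0`. The factor `1 + u/2` is bounded by
  -- the exponential and the remaining one by `σ + 2 d u`.
  refine div_le_of_le_mul₀ (localGradNorm_nonneg f s.1) (hs.potential_nonneg hf ρ)
    ((hs.localGradNorm_next_le hf).trans ?_)
  rw [mul_comm]
  refine mul_le_mul_of_nonneg_right ?_ (localGradNorm_nonneg f s.1)
  rw [potential]
  generalize M * localGradNorm f s.1 = u at *
  generalize excess f s = σ at *
  generalize s.2.2 = η at *
  have h1 : 1 - 1 / (1 + σ) + u / 2 ≤ σ + 2 * d * u := by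
    have : 1 - 1 / (1 + σ) = σ / (1 + σ) := by
      have : 1 + σ ≠ 0 := by positivity
      field_simp
      ring
    have h2 : σ / (1 + σ) ≤ σ := div_le_self hσ (by linarith)
    nlinarith
  have h2 : 1 + u / 2 ≤ Real.exp (4 * (d / ρ) * (η * u)) := by
    have h3 : 1 ≤ (d : ℝ) / ρ := by rw [le_div_iff₀ hρ]; linarith
    have h4 : u ≤ η * u := le_mul_of_one_le_left hu hη
    have h5 : η * u ≤ d / ρ * (η * u) := le_mul_of_one_le_left (hu.trans h4) h3
    have := Real.add_one_le_exp (4 * (d / ρ) * (η * u))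
    linarith
  rw [mul_comm]
  have h3 : 0 ≤ σ + 2 * d * u := by positivity
  gcongr

/-- One factor `1 + u` comes from scaling `G`, another from changing the Hessian in the trace. They
act on `tr (H⁻¹ G) = σ + d`, and `d ((1 + u)² - 1) ≤ (1 + u)² · 2 d u` explains the term `2 d u` in
the potential. -/
theorem Admissible.trace_scaled_le (hf : IsRegular f L μ M) (hs : Admissible f M s) :
    ((hess f (nextPoint f s.1 s.2.1))⁻¹ *
        (scaledEstimator f M s - hess f (nextPoint f s.1 s.2.1))).trace ≤
      (1 + M * localGradNorm f s.1) ^ 2 *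
        (excess f s + 2 * d * (M * localGradNorm f s.1)) := by
  have hu := hf.scaled_nonneg s.1
  have hσ := hs.excess_nonneg hf
  have hH := hf.hess_posDef s.1
  have hA := hf.hess_posDef (nextPoint f s.1 s.2.1)
  have hr := mul_nonneg hf.nonneg (wnorm_nonneg (hess f s.1) (nextPoint f s.1 s.2.1 - s.1))
  have hrl := mul_le_mul_of_nonneg_left (hf.wnorm_step_le hs.le) hf.nonneg
  have hinv := inv_le_smul_inv hH hA (add_nonneg zero_le_one hr)
    (hf.hess_le' s.1 (nextPoint f s.1 s.2.1))
  have htr := trace_mul_mono_left hinv (posDef_of_le hH hs.le).posSemidef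
  have hex : ((hess f s.1)⁻¹ * s.2.1).trace = excess f s + d := by
    rw [excess, mul_sub, inv_mul_of_posDef hH, Matrix.trace_sub, Matrix.trace_one,
      Fintype.card_fin]
    ring
  rw [smul_mul_assoc, Matrix.trace_smul, smul_eq_mul, hex] at htr
  rw [scaledEstimator, mul_sub, inv_mul_of_posDef hA, Matrix.trace_sub, Matrix.trace_one,
    Fintype.card_fin, mul_smul_comm, Matrix.trace_smul, smul_eq_mul]
  generalize M * wnorm (hess f s.1) (nextPoint f s.1 s.2.1 - s.1) = r at *
  generalize M * localGradNorm f s.1 = u at *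
  generalize excess f s = σ at *
  have hd : (0 : ℝ) ≤ d := by positivity
  calc _ ≤ (1 + r) * ((1 + r) * (σ + d)) - d := by gcongr
    _ ≤ (1 + u) * ((1 + u) * (σ + d)) - d := by gcongr
    _ = (1 + u) ^ 2 * σ + d * (2 * u + u ^ 2) := by ring
    _ ≤ (1 + u) ^ 2 * σ + d * ((1 + u) ^ 2 * (2 * u)) := by
        have : 2 * u + u ^ 2 ≤ (1 + u) ^ 2 * (2 * u) := by
          nlinarith [mul_nonneg hu hu, mul_nonneg hu (mul_nonneg hu hu)]
        gcongr
    _ = _ := by ring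

/-- On average over a Gaussian direction, the potential decreases by the factor
`1 - k / (d L / μ)`. -/
theorem Admissible.lintegral_potential_le (hf : IsRegular f L μ M) (hs : Admissible f M s)
    (hd : 2 ≤ d) (hk : k < d) (v : Variant) {ρ : ℝ} (hρ : ρ = 1 - k / (d * (L / μ)))
    (hρ0 : 0 < ρ) (hρ1 : ρ ≤ 1) :
    ∫⁻ x, ENNReal.ofReal (potential f M ρ (BlockQN.stateStep v f M s (arrayMatrix x)))
      ∂(gaussianArray d k) ≤ ENNReal.ofReal (ρ * potential f M ρ s) := by
  have hd' : (2 : ℝ) ≤ d := by exact_mod_cast hd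
  have hμ := hf.pos
  have hL : 0 < L := hμ.trans_le (hf.le_of_pos (by omega))
  have hA := hf.hess_posDef (nextPoint f s.1 s.2.1)
  have hAG := hs.hess_next_le hf
  have hAL := hf.hess_le_smul_one (nextPoint f s.1 s.2.1)
  have htr := hs.trace_scaled_le hf
  have hstep := potential_step_le hd' hρ0 hρ1 (hf.scaled_nonneg s.1) hs.one_le
    (hs.excess_nonneg hf) hs.small (hs.scaled_next_le hf) (hs.scaled_next_le' hf)
  obtain ⟨N, hN⟩ : ∃ N, N = scaledEstimator f M s - hess f (nextPoint f s.1 s.2.1) := ⟨_, rfl⟩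
  obtain ⟨u', hu'e⟩ : ∃ u', u' = M * localGradNorm f (nextPoint f s.1 s.2.1) := ⟨_, rfl⟩
  obtain ⟨C, hC⟩ : ∃ C, C = Real.exp (4 * (d / ρ) *
    ((1 + M * localGradNorm f s.1) ^ 2 * s.2.2 * u')) := ⟨_, rfl⟩
  obtain ⟨τ, hτ⟩ : ∃ τ, τ = ((hess f (nextPoint f s.1 s.2.1))⁻¹ * N).trace := ⟨_, rfl⟩
  have hC0 : 0 < C := hC ▸ Real.exp_pos _
  -- The next point and the next quality bound do not depend on `U`, so `u'` and the exponential `C`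
  -- are constants here; only the trace error is random.
  have hbound : ∀ x : Fin d × Fin k → ℝ,
      potential f M ρ (BlockQN.stateStep v f M s (arrayMatrix x)) ≤
        (τ - L⁻¹ * (colProj (arrayMatrix x) * N).trace + 2 * d * u') * C := by
    intro x
    have h1 := v.trace_update_le hA hAG hL hAL (arrayMatrix x)
    rw [← hN, ← hτ] at h1
    have e : potential f M ρ (BlockQN.stateStep v f M s (arrayMatrix x)) =
        (excess f (BlockQN.stateStep v f M s (arrayMatrix x)) + 2 * d * u') * C := by
      rw [hC, hu'e]; rfl
    rw [e]
    refine mul_le_mul_of_nonneg_right (add_le_add_left ?_ _) hC0.le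
    exact h1
  have hint : Integrable (fun x => (colProj (arrayMatrix x) * N).trace) (gaussianArray d k) := by
    simp only [Matrix.trace, Matrix.diag_apply, Matrix.mul_apply]
    exact integrable_finsetSum _ fun i _ => integrable_finsetSum _ fun j _ =>
      (integrable_colProj i j).mul_const _
  have hint0 : Integrable (fun x => τ - L⁻¹ * (colProj (arrayMatrix x) * N).trace)
      (gaussianArray d k) := (integrable_const τ).sub (hint.const_mul L⁻¹)
  have hint' : Integrable (fun x => (τ - L⁻¹ * (colProj (arrayMatrix x) * N).trace
      + 2 * d * u') * C) (gaussianArray d k) :=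
    (hint0.add (integrable_const (2 * d * u'))).mul_const C
  refine (lintegral_mono fun x => ENNReal.ofReal_le_ofReal (hbound x)).trans ?_
  rw [← ofReal_integral_eq_lintegral_ofReal hint'
    (Filter.Eventually.of_forall fun x => (((hs.stateStep hf v (arrayMatrix x)).potential_nonneg
      hf ρ).trans (hbound x)))]
  refine ENNReal.ofReal_le_ofReal ?_
  have hval : ∫ x, (τ - L⁻¹ * (colProj (arrayMatrix x) * N).trace + 2 * d * u') * C
      ∂(gaussianArray d k) = (τ - L⁻¹ * ((k : ℝ) / d * N.trace) + 2 * d * u') * C := by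
    rw [integral_mul_const, integral_add hint0 (integrable_const _),
      integral_sub (integrable_const τ) (hint.const_mul L⁻¹),
      integral_const_mul, integral_trace_colProj_mul hk.le]
    simp
  have hNpos : N.PosSemidef := hN ▸ Matrix.le_iff.1 hAG
  -- From `μ I ≤ A`: `A⁻¹ ≤ μ⁻¹ I`. With the mean `(k/d) I` this turns the average decrease into `k
  -- μ / (d L) · τ`.
  have htrN : μ * τ ≤ N.trace := by
    have h1 := inv_le_smul_inv (Matrix.PosDef.one (n := Fin d) (R := ℝ)) hA
      (inv_nonneg.2 hμ.le) (c := μ⁻¹) (by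
        have := smul_mono (hf.smul_one_le_hess (nextPoint f s.1 s.2.1)) (inv_nonneg.2 hμ.le)
        rwa [smul_smul, inv_mul_cancel₀ hμ.ne', one_smul] at this)
    have h2 := trace_mul_mono_left h1 hNpos
    rw [inv_one, smul_mul_assoc, one_mul, Matrix.trace_smul, smul_eq_mul, ← hτ] at h2
    rwa [le_inv_mul_iff₀ hμ] at h2
  have hdec : τ - L⁻¹ * ((k : ℝ) / d * N.trace) ≤ ρ * τ := by
    have h1 : L⁻¹ * ((k : ℝ) / d * (μ * τ)) ≤ L⁻¹ * ((k : ℝ) / d * N.trace) := by gcongr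
    have h2 : ρ * τ = τ - L⁻¹ * ((k : ℝ) / d * (μ * τ)) := by
      rw [hρ]
      field_simp
    linarith
  have hτle : τ ≤ (1 + M * localGradNorm f s.1) ^ 2 *
        (excess f s + 2 * d * (M * localGradNorm f s.1)) := by
    rw [hτ, hN]; exact htr
  refine hval.le.trans (le_trans ?_ hstep)
  rw [← hu'e, ← hC]
  refine mul_le_mul_of_nonneg_right ?_ hC0.le
  have := mul_le_mul_of_nonneg_left hτle hρ0.le
  linarith

end Dynamics

/-! ### Measurability, independence and iterated expectation -/

section Expectation

variable {d k : ℕ} {f : EuclideanSpace ℝ (Fin d) → ℝ} {L μ M : ℝ}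
variable {α : Type*} [MeasurableSpace α]

theorem measurable_gradient (hf : TwiceDifferentiable f) : Measurable (gradient f) :=
  hf.2.continuous.measurable

theorem measurable_hess (f : EuclideanSpace ℝ (Fin d) → ℝ) : Measurable (hess f) := by
  refine measurable_matrix_iff.2 fun i j => ?_
  have h := measurable_fderiv_apply_const ℝ (gradient f) (EuclideanSpace.single j (1 : ℝ))
  exact (EuclideanSpace.proj (𝕜 := ℝ) i).continuous.measurable.comp h

theorem measurable_wnorm {A : α → Matrix (Fin d) (Fin d) ℝ} {v : α → EuclideanSpace ℝ (Fin d)}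
    (hA : Measurable A) (hv : Measurable v) : Measurable fun a => wnorm (A a) (v a) := by
  have hv' : Measurable fun a => (v a).ofLp := (WithLp.measurable_ofLp 2 _).comp hv
  exact (measurable_dotProduct hv' (measurable_matrix_mulVec hA hv')).sqrt

theorem measurable_localGradNorm (hf : TwiceDifferentiable f) : Measurable (localGradNorm f) :=
  measurable_wnorm (measurable_matrix_inv (measurable_hess f)) (measurable_gradient hf)

theorem measurable_nextPoint (hf : TwiceDifferentiable f) {x : α → EuclideanSpace ℝ (Fin d)}
    {G : α → Matrix (Fin d) (Fin d) ℝ} (hx : Measurable x) (hG : Measurable G) :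
    Measurable fun a => nextPoint f (x a) (G a) := by
  refine hx.sub ((WithLp.measurable_toLp 2 _).comp ?_)
  exact measurable_matrix_mulVec (measurable_matrix_inv hG)
    ((WithLp.measurable_ofLp 2 _).comp ((measurable_gradient hf).comp hx))

theorem Variant.measurable_update (v : Variant) {G A : α → Matrix (Fin d) (Fin d) ℝ}
    {U : α → Matrix (Fin d) (Fin k) ℝ} (hG : Measurable G) (hA : Measurable A)
    (hU : Measurable U) : Measurable fun a => v.update (G a) (A a) (U a) := by
  have hVA := measurable_sketchInv hA hU
  have hVG := measurable_sketchInv hG hU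
  have hAVA := measurable_matrix_mul (measurable_matrix_mul hA hVA) hA
  cases v
  · simp only [Variant.update, blockBFGS_eq]
    exact measurable_matrix_add (measurable_matrix_sub hG
      (measurable_matrix_mul (measurable_matrix_mul hG hVG) hG)) hAVA
  · simp only [Variant.update, blockDFP_eq]
    exact measurable_matrix_add hAVA (measurable_matrix_mul (measurable_matrix_mul
      (measurable_matrix_sub measurable_const (measurable_matrix_mul hA hVA)) hG)
      (measurable_matrix_sub measurable_const (measurable_matrix_mul hVA hA)))

theorem measurable_stateStep (hf : TwiceDifferentiable f) (v : Variant) (M : ℝ)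
    {s : α → State d} {U : α → Matrix (Fin d) (Fin k) ℝ} (hs : Measurable s) (hU : Measurable U) :
    Measurable fun a => stateStep v f M (s a) (U a) := by
  have hx : Measurable fun a => (s a).1 := measurable_fst.comp hs
  have hG : Measurable fun a => (s a).2.1 := measurable_fst.comp (measurable_snd.comp hs)
  have hη : Measurable fun a => (s a).2.2 := measurable_snd.comp (measurable_snd.comp hs)
  have hy := measurable_nextPoint hf hx hG
  have hr := measurable_wnorm ((measurable_hess f).comp hx) (hy.sub hx)
  refine hy.prodMk (Measurable.prodMk ?_ ?_)
  · exact v.measurable_update (measurable_matrix_smul ((hr.const_mul M).const_add 1) hG)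
      ((measurable_hess f).comp hy) hU
  · exact (((((measurable_localGradNorm hf).comp hx).const_mul M).const_add 1).pow_const 2).mul hη

theorem measurable_stateIterate (hf : TwiceDifferentiable f) (v : Variant) (M : ℝ) (s₀ : State d)
    {U : α → ℕ → Matrix (Fin d) (Fin k) ℝ} (hU : ∀ t, Measurable fun a => U a t) (t : ℕ) :
    Measurable fun a => stateIterate v f M s₀ (U a) t := by
  induction t with
  | zero => exact measurable_const
  | succ t ih => exact measurable_stateStep hf v M ih (hU t)

theorem measurable_potential (hf : TwiceDifferentiable f) (M ρ : ℝ) :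
    Measurable (potential f M ρ) := by
  have hx : Measurable fun s : State d => s.1 := measurable_fst
  have hG : Measurable fun s : State d => s.2.1 := measurable_fst.comp measurable_snd
  have hη : Measurable fun s : State d => s.2.2 := measurable_snd.comp measurable_snd
  have hH := (measurable_hess f).comp hx
  have hu := ((measurable_localGradNorm hf).comp hx).const_mul M
  have hσ : Measurable (excess f) := measurable_matrix_trace
    (measurable_matrix_mul (measurable_matrix_inv hH) (measurable_matrix_sub hG hH))
  exact (hσ.add (hu.const_mul _)).mul ((hη.mul hu).const_mul _).exp

variable {Ω : Type*} [MeasurableSpace Ω] {P : Measure Ω}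

theorem IsGaussianDirections.aemeasurable {U : ℕ → Ω → Matrix (Fin d) (Fin k) ℝ}
    (hU : IsGaussianDirections P U) (p : ℕ × Fin d × Fin k) :
    AEMeasurable (fun ω => U p.1 ω p.2.1 p.2.2) P :=
  (hU.1 p.1 p.2.1 p.2.2).aemeasurable

theorem IsGaussianDirections.map_entries [IsProbabilityMeasure P]
    {U : ℕ → Ω → Matrix (Fin d) (Fin k) ℝ} (hU : IsGaussianDirections P U) (t : ℕ) :
    P.map (fun ω (q : Fin d × Fin k) => U t ω q.1 q.2) = gaussianArray d k := by
  have h := hU.2.precomp (g := fun q : Fin d × Fin k => (t, q)) (Prod.mk_right_injective t)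
  rw [iIndepFun_iff_map_fun_eq_pi_map fun q => hU.aemeasurable (t, q)] at h
  rw [h, gaussianArray]
  congr 1
  ext1 q
  exact (hU.1 t q.1 q.2).map_eq

/-- The directions with the entries recorded in a family indexed by a finite set. -/
def extendDirections (S : Finset (ℕ × Fin d × Fin k)) (g : S → ℝ) (t : ℕ) :
    Matrix (Fin d) (Fin k) ℝ :=
  Matrix.of fun i j => if h : (t, i, j) ∈ S then g ⟨(t, i, j), h⟩ else 0

theorem measurable_extendDirections (S : Finset (ℕ × Fin d × Fin k)) (t : ℕ) :
    Measurable fun g => extendDirections S g t := by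
  refine measurable_matrix_iff.2 fun i j => ?_
  by_cases h : (t, i, j) ∈ S
  · simpa [extendDirections, h] using measurable_pi_apply _
  · simp [extendDirections, h]

/-- The state at time `t` and the directions at time `t` are independent. -/
theorem IsGaussianDirections.lintegral_eq [IsProbabilityMeasure P] (hf : TwiceDifferentiable f)
    {U : ℕ → Ω → Matrix (Fin d) (Fin k) ℝ} (hU : IsGaussianDirections P U) (v : Variant) (M : ℝ)
    (s₀ : State d) (t : ℕ) {F : State d × (Fin d × Fin k → ℝ) → ENNReal} (hF : Measurable F) :
    ∫⁻ ω, F (stateIterate v f M s₀ (fun r => U r ω) t, fun q => U t ω q.1 q.2) ∂P =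
      ∫⁻ ω, ∫⁻ x, F (stateIterate v f M s₀ (fun r => U r ω) t, x) ∂(gaussianArray d k) ∂P := by
  -- `S` indexes the entries drawn before time `t`, `T` those drawn at time `t`. The state at time
  -- `t` uses only directions with index below `t`, so it is a function of the entries in `S`; the
  -- zeros filled in elsewhere are never read.
  let S : Finset (ℕ × Fin d × Fin k) := Finset.range t ×ˢ Finset.univ
  let T : Finset (ℕ × Fin d × Fin k) := {t} ×ˢ Finset.univ
  have hST : Disjoint S T := by
    rw [Finset.disjoint_left]
    rintro ⟨a, b⟩ ha hb
    simp only [S, T, Finset.mem_product, Finset.mem_range, Finset.mem_singleton,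
      Finset.mem_univ, and_true] at ha hb
    omega
  have hind := hU.2.indepFun_finset₀ S T hST hU.aemeasurable
  let Φ : (S → ℝ) → State d := fun g => stateIterate v f M s₀ (extendDirections S g) t
  have hΦ : Measurable Φ := measurable_stateIterate hf v M s₀ (measurable_extendDirections S) t
  let Ψ : (T → ℝ) → (Fin d × Fin k → ℝ) := fun g q => g ⟨(t, q), by simp [T]⟩
  have hΨ : Measurable Ψ := measurable_pi_iff.2 fun q => measurable_pi_apply _
  have hind2 := hind.comp hΦ hΨ
  have e1 : (Φ ∘ fun ω (i : S) => U i.1.1 ω i.1.2.1 i.1.2.2) =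
      fun ω => stateIterate v f M s₀ (fun r => U r ω) t := by
    ext1 ω
    refine stateIterate_congr v f M s₀ fun r hr => ?_
    ext i j
    simp [extendDirections, S, hr]
  have e2 : (Ψ ∘ fun ω (i : T) => U i.1.1 ω i.1.2.1 i.1.2.2) =
      fun ω (q : Fin d × Fin k) => U t ω q.1 q.2 := rfl
  have m1 : AEMeasurable (fun ω => stateIterate v f M s₀ (fun r => U r ω) t) P := by
    rw [← e1]
    exact hΦ.comp_aemeasurable (aemeasurable_pi_lambda _ fun i => hU.aemeasurable i.1)
  have m2 : AEMeasurable (fun ω (q : Fin d × Fin k) => U t ω q.1 q.2) P :=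
    aemeasurable_pi_lambda _ fun q => hU.aemeasurable (t, q)
  rw [e1, e2, indepFun_iff_map_prod_eq_prod_map_map m1 m2, hU.map_entries t] at hind2
  rw [← lintegral_map' (f := F) hF.aemeasurable (m1.prodMk m2), hind2,
    lintegral_prod _ hF.aemeasurable,
    lintegral_map' hF.lintegral_prod_right'.aemeasurable m1]

theorem IsGaussianDirections.aemeasurable_stateIterate (hf : TwiceDifferentiable f)
    {U : ℕ → Ω → Matrix (Fin d) (Fin k) ℝ} (hU : IsGaussianDirections P U) (v : Variant) (M : ℝ)
    (s₀ : State d) (t : ℕ) :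
    AEMeasurable (fun ω => stateIterate v f M s₀ (fun r => U r ω) t) P := by
  have h : AEMeasurable (fun ω r => U r ω) P := aemeasurable_pi_iff.2 fun r =>
    (aemeasurable_pi_iff (X := fun _ : Fin d => Fin k → ℝ)).2 fun i =>
      aemeasurable_pi_iff.2 fun j => hU.aemeasurable (r, i, j)
  exact (measurable_stateIterate hf v M s₀ (U := fun (a : ℕ → Matrix (Fin d) (Fin k) ℝ) => a)
    (fun r => measurable_pi_apply r) t).comp_aemeasurable h

/-- Independence allows averaging over the current direction with the state frozen. Lower integrals
let the recursion run before integrability is known. -/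
theorem lintegral_potential_stateIterate_le [IsProbabilityMeasure P] (hf : IsRegular f L μ M)
    {U : ℕ → Ω → Matrix (Fin d) (Fin k) ℝ} (hU : IsGaussianDirections P U) {s₀ : State d}
    (hs : Admissible f M s₀) (hd : 2 ≤ d) (hk : k < d) (v : Variant) {ρ : ℝ}
    (hρ : ρ = 1 - k / (d * (L / μ))) (hρ0 : 0 < ρ) (hρ1 : ρ ≤ 1) (t : ℕ) :
    ∫⁻ ω, ENNReal.ofReal (potential f M ρ (stateIterate v f M s₀ (fun r => U r ω) t)) ∂P ≤
      ENNReal.ofReal (ρ ^ t * potential f M ρ s₀) := by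
  induction t with
  | zero => simp [stateIterate]
  | succ t ih =>
    have hF : Measurable fun z : State d × (Fin d × Fin k → ℝ) =>
        ENNReal.ofReal (potential f M ρ (stateStep v f M z.1 (arrayMatrix z.2))) :=
      ((measurable_potential hf.twice M ρ).comp (measurable_stateStep hf.twice v M
        measurable_fst (measurable_arrayMatrix.comp measurable_snd))).ennreal_ofReal
    calc _ = ∫⁻ ω, ∫⁻ x, ENNReal.ofReal (potential f M ρ
            (stateStep v f M (stateIterate v f M s₀ (fun r => U r ω) t) (arrayMatrix x)))
            ∂(gaussianArray d k) ∂P := hU.lintegral_eq hf.twice v M s₀ t hF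
      _ ≤ ∫⁻ ω, ENNReal.ofReal
            (ρ * potential f M ρ (stateIterate v f M s₀ (fun r => U r ω) t)) ∂P :=
          lintegral_mono fun ω =>
            (hs.stateIterate hf v _ t).lintegral_potential_le hf hd hk v hρ hρ0 hρ1
      _ = ENNReal.ofReal ρ * ∫⁻ ω, ENNReal.ofReal
            (potential f M ρ (stateIterate v f M s₀ (fun r => U r ω) t)) ∂P := by
          simp only [ENNReal.ofReal_mul hρ0.le]
          exact lintegral_const_mul' _ _ ENNReal.ofReal_ne_top
      _ ≤ ENNReal.ofReal ρ * ENNReal.ofReal (ρ ^ t * potential f M ρ s₀) := by gcongr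
      _ = _ := by rw [← ENNReal.ofReal_mul hρ0.le, pow_succ', mul_assoc]

theorem integrable_and_integral_le_of_lintegral_le {g h : Ω → ℝ} {c : ℝ} (hg : AEMeasurable g P)
    (hg0 : ∀ ω, 0 ≤ g ω) (hgh : ∀ ω, g ω ≤ h ω) (hc : 0 ≤ c)
    (hh : ∫⁻ ω, ENNReal.ofReal (h ω) ∂P ≤ ENNReal.ofReal c) :
    Integrable g P ∧ ∫ ω, g ω ∂P ≤ c := by
  have h1 : ∫⁻ ω, ENNReal.ofReal (g ω) ∂P ≤ ENNReal.ofReal c :=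
    (lintegral_mono fun ω => ENNReal.ofReal_le_ofReal (hgh ω)).trans hh
  refine ⟨⟨hg.aestronglyMeasurable, ?_⟩, ?_⟩
  · rw [hasFiniteIntegral_iff_ofReal (Filter.Eventually.of_forall hg0)]
    exact h1.trans_lt ENNReal.ofReal_lt_top
  · rw [integral_eq_lintegral_of_nonneg_ae (Filter.Eventually.of_forall hg0)
      hg.aestronglyMeasurable]
    exact ENNReal.toReal_le_of_le_ofReal hc h1

/-- The potential of the initial state. -/
theorem potential_le_of_initial (hf : IsRegular f L μ M) {s : State d} (hs : Admissible f M s)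
    {ρ : ℝ} (hd : 2 ≤ d) (hρ0 : 0 < ρ)
    (hsmall : s.2.2 * (M * localGradNorm f s.1) ≤ Real.log 2 / 4 * (ρ / d)) :
    potential f M ρ s ≤ 2 * d * s.2.2 := by
  have hu := hf.scaled_nonneg s.1
  have hη := hs.one_le
  have hd' : (2 : ℝ) ≤ d := by exact_mod_cast hd
  have hd0 : (0 : ℝ) < d := by linarith
  have hσ : excess f s ≤ d * (s.2.2 - 1) := by
    have h1 := trace_mul_mono_right (hf.hess_posDef s.1).inv.posSemidef
      (sub_le_sub_right hs.le_smul (hess f s.1))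
    rw [mul_sub _ (s.2.2 • hess f s.1), mul_smul_comm, inv_mul_of_posDef (hf.hess_posDef s.1),
      Matrix.trace_sub, Matrix.trace_smul, Matrix.trace_one, Fintype.card_fin, smul_eq_mul] at h1
    rw [excess]
    linarith
  have hu' : M * localGradNorm f s.1 ≤ 1 / 2 :=
    (le_mul_of_one_le_left hu hη).trans (hs.small.trans (by norm_num))
  -- The constant `log 2 / 4` is chosen so that the initial exponential is at most `2`; the other
  -- factor is at most `d (η - 1) + d`.
  have hexp : Real.exp (4 * (d / ρ) * (s.2.2 * (M * localGradNorm f s.1))) ≤ 2 := by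
    rw [← Real.le_log_iff_exp_le two_pos]
    calc _ ≤ 4 * (d / ρ) * (Real.log 2 / 4 * (ρ / d)) := by gcongr
      _ = Real.log 2 := by field_simp
  have hσ0 := hs.excess_nonneg hf
  rw [potential]
  generalize M * localGradNorm f s.1 = u at *
  calc _ ≤ (d * s.2.2) * 2 := by
        refine mul_le_mul ?_ hexp (Real.exp_pos _).le (by positivity)
        nlinarith
    _ = 2 * d * s.2.2 := by ring

end Expectation

end BlockQN

end

/-! ### Conclusion for both methods -/

theorem theorem5p5 {d k : ℕ} (hk : 1 ≤ k) (hkd : k < d)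
    (f : EuclideanSpace ℝ (Fin d) → ℝ) (L μ M η₀ : ℝ)
    (hf : BlockQN.TwiceDifferentiable f)
    (hL : BlockQN.IsSmoothWith L f)
    (hμ : 0 < μ) (hconv : StrongConvexOn Set.univ μ f)
    (hM : 0 ≤ M) (hsc : BlockQN.StronglySelfConcordant M f)
    (x₀ : EuclideanSpace ℝ (Fin d)) (G₀ : Matrix (Fin d) (Fin d) ℝ)
    (hη₀ : 1 ≤ η₀)
    (hx₀ : M * BlockQN.localGradNorm f x₀ ≤
      Real.log 2 / 4 * (((d : ℝ) * (L / μ) - (k : ℝ)) / (η₀ * (d : ℝ) ^ 2 * (L / μ))))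
    (hG₀ : BlockQN.hess f x₀ ≤ G₀) (hG₀' : G₀ ≤ η₀ • BlockQN.hess f x₀)
    (v : BlockQN.Variant)
    {Ω : Type*} [MeasurableSpace Ω] (P : Measure Ω) [IsProbabilityMeasure P]
    (U : ℕ → Ω → Matrix (Fin d) (Fin k) ℝ) (hU : BlockQN.IsGaussianDirections P U)
    (t : ℕ) :
    Integrable (fun ω =>
        BlockQN.localGradNorm f (BlockQN.iterate v f M x₀ G₀ (fun s => U s ω) (t + 1)).1 /
          BlockQN.localGradNorm f (BlockQN.iterate v f M x₀ G₀ (fun s => U s ω) t).1) P ∧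
      ∫ ω, BlockQN.localGradNorm f (BlockQN.iterate v f M x₀ G₀ (fun s => U s ω) (t + 1)).1 /
          BlockQN.localGradNorm f (BlockQN.iterate v f M x₀ G₀ (fun s => U s ω) t).1 ∂P ≤
        2 * (d : ℝ) * η₀ * (1 - (k : ℝ) / ((d : ℝ) * (L / μ))) ^ t := by
  have hf' : BlockQN.IsRegular f L μ M := ⟨hf, hL, hμ, hconv, hM, hsc⟩
  have hd : 2 ≤ d := by omega
  have hd2 : (2 : ℝ) ≤ d := by exact_mod_cast hd
  have hd0 : (0 : ℝ) < d := by linarith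
  have hkd' : (k : ℝ) < d := by exact_mod_cast hkd
  have hκ : 1 ≤ L / μ := (one_le_div hμ).2 (hf'.le_of_pos (by omega))
  have hκ0 : 0 < L / μ := by linarith
  have hη0 : 0 < η₀ := by linarith
  obtain ⟨ρ, hρ⟩ : ∃ ρ : ℝ, ρ = 1 - k / (d * (L / μ)) := ⟨_, rfl⟩
  have hρ0 : 0 < ρ := by
    rw [hρ, sub_pos, div_lt_one (by positivity)]
    nlinarith
  have hρ1 : ρ ≤ 1 := by
    rw [hρ]
    linarith [show 0 ≤ (k : ℝ) / (d * (L / μ)) by positivity]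
  -- The hypothesis on `x₀` in terms of `ρ`: `(d κ - k) / (d² κ) = ρ / d`.
  have hsmall : η₀ * (M * BlockQN.localGradNorm f x₀) ≤ Real.log 2 / 4 * (ρ / d) := by
    refine (mul_le_mul_of_nonneg_left hx₀ hη0.le).trans (le_of_eq ?_)
    rw [hρ]
    generalize L / μ = κ at *
    field_simp
  have hs : BlockQN.Admissible f M (x₀, G₀, η₀) := by
    -- Since `ρ ≤ 1` and `d ≥ 2`, the initial `η u` is at most `log 2 / 8 < 0.0867`, the origin of
    -- the constant `867 / 10000`.
    refine ⟨hG₀, hG₀', hη₀, hsmall.trans ?_⟩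
    have h1 : ρ / d ≤ 1 / 2 := by
      rw [div_le_div_iff₀ hd0 two_pos]
      linarith
    have h2 := Real.log_two_lt_d9
    have h3 : 0 ≤ Real.log 2 := Real.log_nonneg one_le_two
    calc Real.log 2 / 4 * (ρ / d) ≤ Real.log 2 / 4 * (1 / 2) := by gcongr
      _ ≤ _ := by norm_num at h2 ⊢; linarith
  have hstate : ∀ ω r, BlockQN.iterate v f M x₀ G₀ (fun s => U s ω) r = _ := fun ω r =>
    BlockQN.iterate_eq_stateIterate v f M (x₀, G₀, η₀) (fun s => U s ω) r
  have hmeas : ∀ r, AEMeasurable (fun ω => BlockQN.localGradNorm f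
      (BlockQN.iterate v f M x₀ G₀ (fun s => U s ω) r).1) P := fun r => by
    simp only [hstate]
    exact ((BlockQN.measurable_localGradNorm hf).comp measurable_fst).comp_aemeasurable
      (hU.aemeasurable_stateIterate hf v M (x₀, G₀, η₀) r)
  rw [← hρ]
  refine BlockQN.integrable_and_integral_le_of_lintegral_le ((hmeas (t + 1)).div (hmeas t))
    (fun ω => div_nonneg (BlockQN.localGradNorm_nonneg f _) (BlockQN.localGradNorm_nonneg f _))
    (h := fun ω => BlockQN.potential f M ρ
      (BlockQN.stateIterate v f M (x₀, G₀, η₀) (fun r => U r ω) t))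
    (fun ω => ?_) (by positivity) ?_
  · rw [hstate, hstate]
    exact (hs.stateIterate hf' v _ t).ratio_le_potential hf' hρ0 hρ1 hd
  · refine (BlockQN.lintegral_potential_stateIterate_le hf' hU hs hd hkd v hρ hρ0 hρ1 t).trans
      (ENNReal.ofReal_le_ofReal ?_)
    rw [mul_comm]
    exact mul_le_mul_of_nonneg_right (BlockQN.potential_le_of_initial hf' hs hd hρ0 hsmall)
      (by positivity)
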